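/- **Definitions.** Let $\Delta$ be a finite abstract simplicial complex of dimension at most $2$. A triangle of $\Delta$ is *external* if it has an edge that lies in no other triangle of $\Delta$; *erasing* an external triangle means removing it from the complex. $\Delta$ is *erasable* if successive erasures of triangles (each external in the complex at hand) lead to a complex without triangles, and $\operatorname{er}(\Delta)$ is the least size of a set $\Delta_0$ of triangles such that $\Delta\setminus\Delta_0$ is erasable. **Erasability** asks, given $\Delta$ and the parameter $k\in\mathbb{N}=\{0,1,2,\dots\}$, whether $\operatorname{er}(\Delta)\le k$. **Minimum Axiom Set** asks, given a finite set $S$ (of sentences), a set $R$ of pairs $(U,s)$ with $U\subseteq S$ and $s\in S$ (the implications), and the parameter $k\in\mathbb{N}$, whether there are $S_0\subseteq S$ with $|S_0|\le k$ and $n\ge 1$ with $S_n=S$, where $S_i$ consists of those $s\in S$ such that $s\in S_{i-1}$ or $(U,s)\in R$ for some $U\subseteq S_{i-1}$. A *parameterized (FPT) reduction* from $L$ to $L'$ is a map $(x,k)\mapsto(x',g(k))$ such that $(x,k)$ is a yes-instance of $L$ if and only if $(x',g(k))$ is a yes-instance of $L'$, and which is computed by one Turing machine in time $f(k)\,|x|^{O(1)}$;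 here $f,g:\mathbb{N}\to\mathbb{N}$ are arbitrary functions. $W[P]$ is the class of parameterized problems that have a parameterized reduction to Weighted Circuit Satisfiability: given a Boolean circuit (of unbounded depth) and the parameter $k$, is there a satisfying assignment with exactly $k$ true inputs? **Theorem.** There is a parameterized reduction from Erasability to Minimum Axiom Set that keeps the parameter, $(\Delta,k)\mapsto(S,R,k)$, such that for every instance $(\Delta,k)$ the set $S$ is in one-to-one correspondence with the set of triangles of $\Delta$ and, under this correspondence, $$R=\{(S_e\setminus\{s\},\,s)\;:\;e\text{ an edge of }\Delta,\ s\in S_e\},$$ where $S_e$ denotes the set of sentences that correspond to the triangles containing $e$. Moreover, Erasability belongs to $W[P]$. -/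

import Mathlib

namespace ParamMorse

/-! ### Erasability of two-dimensional simplicial complexes -/

/-- A finite abstract simplicial complex of dimension at most two with vertices in `V`. -/
structure Complex2 (V : Type) extends PreAbstractSimplicialComplex V where
  card_le_three : ∀ s ∈ faces, s.card ≤ 3
  finite_faces : faces.Finite

namespace Complex2

variable {V : Type}

/-- The set of triangles (2-simplexes) of the complex. -/
def triangles (D : Complex2 V) : Set (Finset V) := {t | t ∈ D.faces ∧ t.card = 3}

/-- The set of edges (1-simplexes) of the complex. -/
def edges (D : Complex2 V) : Set (Finset V) := {e | e ∈ D.faces ∧ e.card = 2}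

/-- The set of all triangles of the complex that contain `e`. -/
def star (D : Complex2 V) (e : Finset V) : Set (Finset V) := {t | t ∈ D.triangles ∧ e ⊆ t}

/-- A triangle is external if it has an edge that lies in no other triangle of the complex. -/
def IsExternal (D : Complex2 V) (t : Finset V) : Prop :=
  t ∈ D.triangles ∧ ∃ e ∈ D.edges, e ⊆ t ∧ ∀ t' ∈ D.triangles, e ⊆ t' → t' = t

/-- The complex obtained by removing the triangles in `T` (and no face of lower dimension). -/
def removeTriangles (D : Complex2 V) (T : Set (Finset V)) : Complex2 V where
  faces := {s | s ∈ D.faces ∧ ¬ (s.card = 3 ∧ s ∈ T)}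
  isRelLowerSet_faces := by
    rintro s ⟨hs, hsT⟩
    refine ⟨(D.isRelLowerSet_faces hs).1, fun s' hle hne => ?_⟩
    refine ⟨(D.isRelLowerSet_faces hs).2 hle hne, fun h => hsT ?_⟩
    have hc := D.card_le_three s hs
    have heq : s' = s := Finset.eq_of_subset_of_card_le hle (by omega)
    exact heq ▸ h
  card_le_three := fun s hs => D.card_le_three s hs.1
  finite_faces := D.finite_faces.subset fun _ hs => hs.1

/-- One erasing step: removal of one triangle that is external in the current complex. -/
def EraseStep (D D' : Complex2 V) : Prop :=
  ∃ t, D.IsExternal t ∧ D' = D.removeTriangles {t}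

/-- The complex can be transformed into one without triangles by erasing steps. -/
def IsErasable (D : Complex2 V) : Prop :=
  ∃ D' : Complex2 V, Relation.ReflTransGen EraseStep D D' ∧ D'.triangles = ∅

/-- The least size of a set of triangles whose removal makes the complex erasable. (The set of
all triangles is always such a set, so the infimum is over a nonempty set.) -/
noncomputable def er (D : Complex2 V) : ℕ :=
  sInf {n | ∃ C : Finset (Finset V), (C : Set (Finset V)) ⊆ D.triangles ∧ C.card = n ∧
    (D.removeTriangles C).IsErasable}

end Complex2

/-! ### Axiom sets -/

/-- A finite set of sentences with an implication relation consisting of pairs `(U, s)`, where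
`U` is a set of sentences and `s` is a sentence. -/
structure AxiomSystem (α : Type) where
  sentences : Finset α
  rules : Set (Finset α × α)
  rules_mem : ∀ r ∈ rules, r.1 ⊆ sentences ∧ r.2 ∈ sentences

namespace AxiomSystem

variable {α : Type}

/-- The sentences that lie in `X` or are implied by a subset of `X`. -/
def infer (A : AxiomSystem α) (X : Set α) : Set α :=
  {s | s ∈ A.sentences ∧ (s ∈ X ∨ ∃ U : Finset α, (U : Set α) ⊆ X ∧ (U, s) ∈ A.rules)}

/-- `S₀` is an axiom set: all sentences are reached from `S₀` in finitely many rounds. -/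
def IsAxiomSet (A : AxiomSystem α) (S₀ : Finset α) : Prop :=
  S₀ ⊆ A.sentences ∧ ∃ n : ℕ, 0 < n ∧ A.infer^[n] (S₀ : Set α) = (A.sentences : Set α)

end AxiomSystem

/-- `A` arises from `D` by taking the triangles as sentences (under the one-to-one
correspondence `σ`) and, for every edge `e` and every triangle `t` containing `e`, the
implication from all other triangles containing `e` to `t`. -/
def IsEdgeStarSystem {V α : Type} (D : Complex2 V) (A : AxiomSystem α) : Prop :=
  ∃ σ : Finset V → α, Set.BijOn σ D.triangles (A.sentences : Set α) ∧
    ∀ (U : Finset α) (s : α), (U, s) ∈ A.rules ↔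
      ∃ e ∈ D.edges, ∃ t ∈ D.star e, (U : Set α) = σ '' (D.star e \ {t}) ∧ s = σ t

/-! ### Parameterized problems and reductions -/

/-- A parameterized problem: instances `(x, k)` with `k : ℕ`, where `x` is written as a word over
a finite alphabet, and the set of yes-instances. -/
structure ParamProblem where
  Inst : Type
  Letters : Type
  finite_letters : Finite Letters
  encode : Inst → List Letters
  encode_injective : Function.Injective encode
  Yes : Inst → ℕ → Prop

/-- The input word of `(x, k)`: the word of `x`, followed by `k` copies of a fresh letter. (Running
times may depend on `k` arbitrarily, so the tally notation is no restriction.) -/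
def ParamProblem.word (P : ParamProblem) (x : P.Inst) (k : ℕ) : List (Option P.Letters) :=
  (P.encode x).map some ++ List.replicate k none

/-- The map `(x, k) ↦ (T x k, g k)` preserves and reflects yes-instances, and some Turing machine
computes it in at most `f(k) * (|x| + 1) ^ c` steps, for a function `f` and a constant `c`. -/
def IsFPTReduction (P Q : ParamProblem) (T : P.Inst → ℕ → Q.Inst) (g : ℕ → ℕ) : Prop :=
  (∀ x k, P.Yes x k ↔ Q.Yes (T x k) (g k)) ∧
  ∃ (M : Turing.TM2ComputableAux (Option P.Letters) (Option Q.Letters)) (f : ℕ → ℕ) (c : ℕ),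
    ∀ x k, Nonempty (Turing.TM2OutputsInTime M.tm
      ((P.word x k).map M.inputAlphabet.symm)
      (some ((Q.word (T x k) (g k)).map M.outputAlphabet.symm))
      (f k * ((P.encode x).length + 1) ^ c))

/-- `P` is reducible to `Q` by a parameterized reduction. -/
def FPTReducible (P Q : ParamProblem) : Prop :=
  ∃ (T : P.Inst → ℕ → Q.Inst) (g : ℕ → ℕ), IsFPTReduction P Q T g

/-! ### Words -/

/-- Names of vertices, sentences and gates: words over `{0, 1}`. -/
abbrev Word := List Bool

/-- The alphabet in which instances are written: bits and two end marks. -/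
inductive Letter where
  | bit (b : Bool)
  | comma
  | semi

instance Letter.instFinite : Finite Letter :=
  Finite.of_injective
    (fun l : Letter => match l with
      | .bit b => (some (some b) : Option (Option Bool))
      | .comma => some none
      | .semi => none)
    (by intro a b h; cases a <;> cases b <;> simp_all)

/-- A word, followed by a comma. -/
def encWord (w : Word) : List Letter := w.map Letter.bit ++ [Letter.comma]

/-- A list of words, each followed by a comma, with a semicolon at the end. -/
def encRow (l : List Word) : List Letter := l.flatMap encWord ++ [Letter.semi]

/-- A list of lists of words. -/
def encTable (t : List (List Word)) : List Letter := t.flatMap encRow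

theorem encWord_append_inj : ∀ {w w' : Word} {r r' : List Letter},
    encWord w ++ r = encWord w' ++ r' → w = w' ∧ r = r'
  | [], [], _, _, h => by simpa [encWord] using h
  | [], _ :: _, _, _, h => by simp [encWord] at h
  | _ :: _, [], _, _, h => by simp [encWord] at h
  | b :: w, b' :: w', r, r', h => by
    have h' : b = b' ∧ encWord w ++ r = encWord w' ++ r' := by simpa [encWord] using h
    obtain ⟨h1, h2⟩ := encWord_append_inj h'.2
    exact ⟨by rw [h'.1, h1], h2⟩

theorem encWord_append_ne_semi (w : Word) (r r' : List Letter) :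
    encWord w ++ r ≠ Letter.semi :: r' := by
  cases w <;> simp [encWord]

theorem encRow_append_inj : ∀ {l l' : List Word} {r r' : List Letter},
    encRow l ++ r = encRow l' ++ r' → l = l' ∧ r = r'
  | [], [], _, _, h => by simpa [encRow] using h
  | [], w :: l, r, r', h => by
    refine absurd ?_ (encWord_append_ne_semi w (encRow l ++ r') r)
    simpa [encRow] using h.symm
  | w :: l, [], r, r', h => by
    refine absurd ?_ (encWord_append_ne_semi w (encRow l ++ r) r')
    simpa [encRow] using h
  | w :: l, w' :: l', r, r', h => by
    have h' : encWord w ++ (encRow l ++ r) = encWord w' ++ (encRow l' ++ r') := by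
      simpa [encRow] using h
    obtain ⟨h1, h2⟩ := encWord_append_inj h'
    obtain ⟨h3, h4⟩ := encRow_append_inj h2
    exact ⟨by rw [h1, h3], h4⟩

theorem encTable_injective : Function.Injective encTable := by
  intro t
  induction t with
  | nil =>
    rintro (_ | ⟨l, t'⟩) h
    · rfl
    · simp [encTable, encRow] at h
  | cons l t ih =>
    rintro (_ | ⟨l', t'⟩) h
    · simp [encTable, encRow] at h
    · have h' : encRow l ++ encTable t = encRow l' ++ encTable t' := by
        simpa [encTable] using h
      obtain ⟨h1, h2⟩ := encRow_append_inj h'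
      rw [h1, ih h2]

/-! ### The problem Erasability -/

/-- A finite two-dimensional complex, given by a list of generating simplexes without repetition
(for instance its maximal simplexes, or all of its simplexes), each written as the list of its
vertices. -/
@[ext]
structure ComplexCode where
  simplexes : List (List Word)
  ne_nil : ∀ l ∈ simplexes, l ≠ []
  nodup_vertices : ∀ l ∈ simplexes, l.Nodup
  length_le_three : ∀ l ∈ simplexes, l.length ≤ 3
  nodup : (simplexes.map List.toFinset).Nodup

/-- The complex that is generated by the listed simplexes. -/
def ComplexCode.complex (x : ComplexCode) : Complex2 Word where
  faces := {s | s.Nonempty ∧ ∃ l ∈ x.simplexes, s ⊆ l.toFinset}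
  isRelLowerSet_faces := by
    rintro s ⟨hs, l, hl, hsl⟩
    exact ⟨hs, fun s' hle hne => ⟨hne, l, hl, hle.trans hsl⟩⟩
  card_le_three := by
    rintro s ⟨-, l, hl, hsl⟩
    exact (Finset.card_le_card hsl).trans
      ((List.toFinset_card_le l).trans (x.length_le_three l hl))
  finite_faces := by
    refine Set.Finite.subset
      (x.simplexes.toFinset.biUnion fun l => l.toFinset.powerset).finite_toSet ?_
    rintro s ⟨-, l, hl, hsl⟩
    simp only [Finset.coe_biUnion, Set.mem_iUnion, Finset.mem_coe, Finset.mem_powerset]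
    exact ⟨l, List.mem_toFinset.2 hl, hsl⟩

/-- Erasability: given a two-dimensional complex and `k`, is its erasability number at most `k`? -/
noncomputable def erasability : ParamProblem where
  Inst := ComplexCode
  Letters := Letter
  finite_letters := inferInstance
  encode := fun x => encTable x.simplexes
  encode_injective := fun _ _ h => ComplexCode.ext (encTable_injective h)
  Yes := fun x k => x.complex.er ≤ k

/-! ### The problem Minimum Axiom Set -/

/-- A system of sentences and implications: the list of sentences, and the list of the
implications, each of them given by its list of premises and its conclusion. -/
@[ext]
structure AxiomCode where
  sentences : List Word
  nodup : sentences.Nodup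
  rules : List (List Word × Word)
  rules_mem : ∀ r ∈ rules, (∀ u ∈ r.1, u ∈ sentences) ∧ r.2 ∈ sentences

/-- The system that is described by the lists. -/
def AxiomCode.system (x : AxiomCode) : AxiomSystem Word where
  sentences := x.sentences.toFinset
  rules := {p | ∃ r ∈ x.rules, p = (r.1.toFinset, r.2)}
  rules_mem := by
    rintro _ ⟨r, hr, rfl⟩
    obtain ⟨h1, h2⟩ := x.rules_mem r hr
    exact ⟨fun u hu => List.mem_toFinset.2 (h1 u (List.mem_toFinset.1 hu)),
      List.mem_toFinset.2 h2⟩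

/-- The table of a system: the row of sentences, then one row for each implication, its conclusion
followed by its premises. -/
def AxiomCode.table (x : AxiomCode) : List (List Word) :=
  x.sentences :: x.rules.map fun r => r.2 :: r.1

theorem AxiomCode.table_injective : Function.Injective AxiomCode.table := by
  intro x y h
  have h' := List.cons.inj h
  refine AxiomCode.ext h'.1 ((List.map_injective_iff.2 ?_) h'.2)
  rintro ⟨U, s⟩ ⟨U', s'⟩ he
  have he' := List.cons.inj he
  exact Prod.ext he'.2 he'.1

/-- Minimum Axiom Set: given a system of sentences and implications and `k`, is there an axiom set
with at most `k` elements? -/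
def minimumAxiomSet : ParamProblem where
  Inst := AxiomCode
  Letters := Letter
  finite_letters := inferInstance
  encode := fun x => encTable x.table
  encode_injective := encTable_injective.comp AxiomCode.table_injective
  Yes := fun x k => ∃ S₀ : Finset Word, S₀.card ≤ k ∧ x.system.IsAxiomSet S₀

/-! ### Weighted circuit satisfiability and the class W[P] -/

/-- The kinds of gates of a Boolean circuit. -/
inductive GateKind where
  | input
  | not
  | and
  | or

/-- A gate with its name and the names of the gates that feed it. -/
@[ext]
structure Gate where
  name : Word
  kind : GateKind
  preds : List Word

/-- A Boolean circuit: a list of gates in topological order, the last one being the output gate.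
Conjunctions and disjunctions have arbitrary finite fan-in; depth is not bounded. -/
@[ext]
structure Circuit where
  gates : List Gate
  ne_nil : gates ≠ []
  nodup : (gates.map Gate.name).Nodup
  arity_input : ∀ g ∈ gates, g.kind = GateKind.input → g.preds = []
  arity_not : ∀ g ∈ gates, g.kind = GateKind.not → g.preds.length = 1
  topological : ∀ (l₁ : List Gate) (g : Gate) (l₂ : List Gate), gates = l₁ ++ g :: l₂ →
    ∀ p ∈ g.preds, p ∈ l₁.map Gate.name

/-- The value of a gate, where `a` is the set of true inputs and `v` gives the values of the
preceding gates. -/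
def Gate.value (a : Finset Word) (v : Word → Bool) (g : Gate) : Bool :=
  match g.kind with
  | GateKind.input => decide (g.name ∈ a)
  | GateKind.not => g.preds.all fun p => !(v p)
  | GateKind.and => g.preds.all v
  | GateKind.or => g.preds.any v

/-- The values of all gates, computed along the topological order. -/
def Circuit.eval (C : Circuit) (a : Finset Word) : Word → Bool :=
  C.gates.foldl (fun v g => Function.update v g.name (g.value a v)) fun _ => false

/-- The names of the input gates. -/
def Circuit.inputs (C : Circuit) : Set Word :=
  {w | ∃ g ∈ C.gates, g.kind = GateKind.input ∧ g.name = w}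

/-- The circuit outputs true if exactly the inputs in `a` are true. -/
def Circuit.Accepts (C : Circuit) (a : Finset Word) : Prop :=
  C.eval a (C.gates.getLast C.ne_nil).name = true

/-- The word that stands for a kind of gate. -/
def GateKind.code : GateKind → Word
  | input => [false, false]
  | not => [false, true]
  | and => [true, false]
  | or => [true, true]

theorem GateKind.code_injective : Function.Injective GateKind.code := by
  intro a b h
  cases a <;> cases b <;> simp_all [GateKind.code]

/-- The table of a circuit: for each gate its kind, its name and its predecessors. -/
def Circuit.table (C : Circuit) : List (List Word) :=
  C.gates.map fun g => g.kind.code :: g.name :: g.preds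

theorem Circuit.table_injective : Function.Injective Circuit.table := by
  intro C C' h
  refine Circuit.ext ((List.map_injective_iff.2 ?_) h)
  rintro ⟨n, d, p⟩ ⟨n', d', p'⟩ he
  have h1 := List.cons.inj he
  have h2 := List.cons.inj h1.2
  exact Gate.ext h2.1 (GateKind.code_injective h1.1) h2.2

/-- Weighted circuit satisfiability: given a Boolean circuit and `k`, is there a satisfying
assignment in which exactly `k` inputs are true? -/
def weightedCircuitSat : ParamProblem where
  Inst := Circuit
  Letters := Letter
  finite_letters := inferInstance
  encode := fun C => encTable C.table
  encode_injective := encTable_injective.comp Circuit.table_injective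
  Yes := fun C k => ∃ a : Finset Word, (a : Set Word) ⊆ C.inputs ∧ a.card = k ∧ C.Accepts a

/-- The class W[P]: the parameterized problems that are reducible to weighted circuit
satisfiability (for circuits of unbounded depth). -/
def InWP (P : ParamProblem) : Prop := FPTReducible P weightedCircuitSat

end ParamMorse

/-! The combinatorial core is that erasing is a monotone closure process. After the triangles in `X`
have gone, the next ones that may go are those having an edge all of whose other triangles lie in
`X`; `spread` adds all of them at once. Since `spread` is monotone, an external triangle stays
external until it is erased, so the order of erasures is irrelevant. Hence `C` is a valid set of
triangles to remove exactly if some iterate of `spread` on `C` contains every triangle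
(`isErasable_removeTriangles_iff`).

One round of inference in the system of edge stars is the same operator, transported along the
bijection between triangles and sentences (`infer_image`). Removal sets therefore correspond to
axiom sets of the same size, and the parameter is kept (`er_le_iff_exists_isAxiomSet`).

For membership in W[P], the rounds are unrolled into a circuit. Each round before stabilization adds
a triangle, so as many rounds as there are triangles suffice (`iterate_spread_eq_triangles`), and
each round becomes a layer of conjunctions and disjunctions. The inputs select the removed
triangles; `k` inputs without effect turn "at most `k`" into "exactly `k`"
(`er_le_iff_exists_accepts`).

The remaining burden is the running time. Both maps are nested loops over pieces of the input, so
they are written as expressions of the language `Exp`. An expression loops only over words that are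
already computed, which bounds sizes and times by polynomials. Expressions are compiled into
structured stack programs (`runsIn_compile`), and these are simulated step by step by Turing
machines (`Runs.simulate`). It is then enough to evaluate one expression for each reduction
(`apply_axiomExp`, `apply_circuitExp`). The parameter is part of the input in tally notation; its
contribution to the time is split off as a factor in `exists_machine_of_exp`. -/

/-! ### Structured programs on stacks -/

namespace StackProgram

/-- Structured programs that work on stacks with names in `K` over the alphabet `Γ`. The command
`case k f` pops the stack `k` and continues according to the symbol that was found; `loop k f` does
so until the stack `k` is empty. -/
inductive Cmd (K Γ : Type) where
  | skip : Cmd K Γ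
  | push (k : K) (a : Γ) : Cmd K Γ
  | seq (c d : Cmd K Γ) : Cmd K Γ
  | case (k : K) (f : Option Γ → Cmd K Γ) : Cmd K Γ
  | loop (k : K) (f : Γ → Cmd K Γ) : Cmd K Γ

namespace Cmd

variable {K Γ : Type}

/-- The program points of a program. -/
def Lab : Cmd K Γ → Type
  | skip => Unit
  | push _ _ => Unit
  | seq c d => Lab c ⊕ Lab d
  | case _ f => Option (Σ a, Lab (f a))
  | loop _ f => Option (Σ a, Lab (f a))

/-- The program point at which a program starts. -/
def entry : (c : Cmd K Γ) → Lab c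
  | skip => ()
  | push _ _ => ()
  | seq c _ => Sum.inl (entry c)
  | case _ _ => none
  | loop _ _ => none

/-- A program has finitely many program points. -/
@[reducible]
def labFintype [Fintype Γ] : (c : Cmd K Γ) → Fintype (Lab c)
  | skip => inferInstanceAs (Fintype Unit)
  | push _ _ => inferInstanceAs (Fintype Unit)
  | seq c d =>
    letI := labFintype c
    letI := labFintype d
    inferInstanceAs (Fintype (Lab c ⊕ Lab d))
  | case _ f =>
    letI := fun a => labFintype (f a)
    inferInstanceAs (Fintype (Option (Σ a, Lab (f a))))
  | loop _ f =>
    letI := fun a => labFintype (f a)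
    inferInstanceAs (Fintype (Option (Σ a, Lab (f a))))

/-- The stacks that occur in a program. -/
def keys [DecidableEq K] [Fintype Γ] : Cmd K Γ → Finset K
  | skip => ∅
  | push k _ => {k}
  | seq c d => keys c ∪ keys d
  | case k f => {k} ∪ Finset.univ.biUnion fun a => keys (f a)
  | loop k f => {k} ∪ Finset.univ.biUnion fun a => keys (f a)

/-- The statements of a stack machine that carry out the program, where program points are embedded
into the labels of the machine, and `next` is the label at which the machine continues. -/
def code {Λ K' : Type} (r : K → K') : (c : Cmd K Γ) → (Lab c → Λ) → Λ → Lab c →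
    Turing.TM2.Stmt (fun _ : K' => Γ) Λ (Option Γ)
  | skip, _, next, _ => .goto fun _ => next
  | push k a, _, next, _ => .push (r k) (fun _ => a) (.goto fun _ => next)
  | seq c d, emb, next, l =>
    match l with
    | Sum.inl l => code r c (fun l => emb (Sum.inl l)) (emb (Sum.inr (entry d))) l
    | Sum.inr l => code r d (fun l => emb (Sum.inr l)) next l
  | case k f, emb, next, l =>
    match l with
    | none => .pop (r k) (fun _ x => x) (.goto fun v => emb (some ⟨v, entry (f v)⟩))
    | some ⟨a, l⟩ => code r (f a) (fun l => emb (some ⟨a, l⟩)) next l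
  | loop k f, emb, next, l =>
    match l with
    | none => .pop (r k) (fun _ x => x) (.goto fun v =>
        match v with
        | none => next
        | some a => emb (some ⟨a, entry (f a)⟩))
    | some ⟨a, l⟩ => code r (f a) (fun l => emb (some ⟨a, l⟩)) (emb none) l

/-- `Runs c S S' t`: the program transforms the stacks `S` into `S'` in `t` steps. -/
inductive Runs [DecidableEq K] : Cmd K Γ → (K → List Γ) → (K → List Γ) → ℕ → Prop
  | skip (S) : Runs skip S S 1
  | push (k a S) : Runs (push k a) S (Function.update S k (a :: S k)) 1
  | seq {c d S S₁ S₂ t₁ t₂} : Runs c S S₁ t₁ → Runs d S₁ S₂ t₂ → Runs (seq c d) S S₂ (t₁ + t₂)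
  | case {k f S S₁ t} : Runs (f (S k).head?) (Function.update S k (S k).tail) S₁ t →
      Runs (case k f) S S₁ (1 + t)
  | loop_nil {k f S} : S k = [] → Runs (loop k f) S S 1
  | loop_cons {k f S S₁ S₂ a l t₁ t₂} : S k = a :: l → Runs (f a) (Function.update S k l) S₁ t₁ →
      Runs (loop k f) S₁ S₂ t₂ → Runs (loop k f) S S₂ (1 + t₁ + t₂)

/-! ### Simulation of programs by Turing machines -/

theorem update_comp_val [DecidableEq K] {F : Finset K} (S : K → List Γ) (k : F) (l : List Γ) :
    (fun j : F => Function.update S k.1 l j.1) = Function.update (fun j : F => S j.1) k l := by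
  funext j
  by_cases h : j = k
  · subst h; simp
  · rw [Function.update_of_ne h, Function.update_of_ne (fun h' => h (Subtype.ext h'))]

theorem iterate_step_add {σ : Type} {f : σ → Option σ} {a b c : Option σ} {s t : ℕ}
    (h₁ : (flip bind f)^[s] a = b) (h₂ : (flip bind f)^[t] b = c) :
    (flip bind f)^[s + t] a = c := by
  rw [Nat.add_comm, Function.iterate_add_apply, h₁, h₂]

/-- Every unit of time in `Runs` is one machine step, because a statement runs up to its `goto` in a
single step. The induction varies `emb` and `next`: a subprogram is executed at the labels embedded
through its parent, and for a loop body the continuation is the head of the loop. The stacks are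
restricted to a finite set `F`, as the machine has finitely many while `K` may be infinite. The
final register content is irrelevant, hence existential. -/
theorem Runs.simulate [DecidableEq K] [Fintype Γ] {F : Finset K} {r : K → F} {Λ : Type}
    {m : Λ → Turing.TM2.Stmt (fun _ : F => Γ) Λ (Option Γ)}
    {c : Cmd K Γ} {S S' : K → List Γ} {t : ℕ} (h : Runs c S S' t)
    (hr : ∀ k ∈ keys c, (r k : K) = k) {emb : Lab c → Λ} {next : Λ}
    (hm : ∀ l, m (emb l) = code r c emb next l) (v : Option Γ) :
    ∃ v', (flip bind (Turing.TM2.step m))^[t]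
      (some ⟨some (emb (entry c)), v, fun k => S k⟩) =
      some ⟨some next, v', fun k => S' k⟩ := by
  induction h generalizing v next with
  | skip S =>
    refine ⟨v, ?_⟩
    have hm' := hm (entry Cmd.skip)
    simp only [code] at hm'
    simp [flip, hm']
  | push k a S =>
    refine ⟨v, ?_⟩
    have hk : (r k : K) = k := hr k (by simp [keys])
    have := update_comp_val S (r k) (a :: S k)
    rw [hk] at this
    have hm' := hm (entry (Cmd.push k a))
    simp only [code] at hm'
    simp [flip, hm', this, hk]
  | @seq c d S S₁ S₂ t₁ t₂ h₁ h₂ ih₁ ih₂ =>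
    obtain ⟨v₁, h₁⟩ := ih₁ (fun k hk => hr k (by simp [keys, hk]))
      (emb := fun l => emb (Sum.inl l)) (fun l => hm (Sum.inl l)) v
    obtain ⟨v₂, h₂⟩ := ih₂ (fun k hk => hr k (by simp [keys, hk]))
      (emb := fun l => emb (Sum.inr l)) (fun l => hm (Sum.inr l)) v₁
    exact ⟨v₂, iterate_step_add h₁ h₂⟩
  | @case k f S S₁ t h ih =>
    have hk : (r k : K) = k := hr k (by simp [keys])
    obtain ⟨v₁, h₁⟩ := ih (fun j hj => hr j (by
        simp only [keys, Finset.mem_union, Finset.mem_biUnion, Finset.mem_univ, true_and]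
        exact Or.inr ⟨_, hj⟩))
      (emb := fun l => emb (some ⟨_, l⟩)) (fun l => hm (some ⟨_, l⟩)) (S k).head?
    refine ⟨v₁, iterate_step_add ?_ h₁⟩
    have := update_comp_val S (r k) (S k).tail
    rw [hk] at this
    have hm' := hm none
    simp only [code] at hm'
    simp [flip, entry, hm', this, hk]
  | @loop_nil k f S h =>
    have hk : (r k : K) = k := hr k (by simp [keys])
    refine ⟨none, ?_⟩
    have := update_comp_val S (r k) []
    have hS : Function.update S k [] = S := by rw [← h, Function.update_eq_self]
    rw [hk, hS] at this
    have hm' := hm none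
    simp only [code] at hm'
    simp [flip, entry, hm', hk, h, ← this]
  | @loop_cons k f S S₁ S₂ a l t₁ t₂ h h₁ h₂ ih₁ ih₂ =>
    have hk : (r k : K) = k := hr k (by simp [keys])
    obtain ⟨v₁, h₁⟩ := ih₁ (fun j hj => hr j (by
        simp only [keys, Finset.mem_union, Finset.mem_biUnion, Finset.mem_univ, true_and]
        exact Or.inr ⟨_, hj⟩))
      (emb := fun l => emb (some ⟨_, l⟩)) (fun l => hm (some ⟨_, l⟩)) (some a)
    obtain ⟨v₂, h₂⟩ := ih₂ hr hm v₁
    refine ⟨v₂, iterate_step_add (iterate_step_add ?_ h₁) h₂⟩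
    have := update_comp_val S (r k) l
    rw [hk] at this
    have hm' := hm none
    simp only [code] at hm'
    simp [flip, entry, hm', this, hk, h]

/-- The stack machine that carries out a program with given input and output stacks. -/
def machine [DecidableEq K] [Fintype Γ] (c : Cmd K Γ) (i o : K) : Turing.FinTM2 :=
  letI := labFintype c
  { K := (insert i (insert o (keys c)) : Finset K)
    k₀ := ⟨i, by simp⟩
    k₁ := ⟨o, by simp⟩
    Γ := fun _ => Γ
    Λ := Option (Lab c)
    main := some (entry c)
    σ := Option Γ
    initialState := none
    Γk₀Fin := inferInstanceAs (Fintype Γ)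
    m := fun l =>
      match l with
      | none => .load (fun _ => none) .halt
      | some l => code (fun k => if h : k ∈ insert i (insert o (keys c)) then ⟨k, h⟩
          else ⟨i, by simp⟩) c some none l }

/-- The step beyond `t` is spent at the label `none`, which resets the register to its initial
state, as `haltList` demands, and halts. The latter also demands that all stacks other than the
output stack are empty. -/
theorem Runs.outputs [DecidableEq K] [Fintype Γ] {c : Cmd K Γ} {i o : K} {x y : List Γ} {t T : ℕ}
    (h : Runs c (Function.update (fun _ => []) i x) (Function.update (fun _ => []) o y) t)
    (hT : t + 1 ≤ T) :
    Nonempty (Turing.TM2OutputsInTime (machine c i o) x (some y) T) := by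
  let := labFintype c
  obtain ⟨v, hv⟩ := h.simulate (F := insert i (insert o (keys c)))
    (r := fun k => if h : k ∈ insert i (insert o (keys c)) then ⟨k, h⟩ else ⟨i, by simp⟩)
    (Λ := Option (Lab c)) (emb := some) (next := none) (m := (machine c i o).m)
    (fun k hk => by simp [hk]) (fun l => rfl) none
  refine ⟨⟨⟨t + 1, iterate_step_add
    (b := some ⟨some none, v, fun k => Function.update (fun _ => []) o y k.1⟩) ?_ ?_⟩, hT⟩⟩
  · have hi : (fun k : (insert i (insert o (keys c)) : Finset K) =>
        Function.update (fun _ => ([] : List Γ)) i x k.1) =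
        (Turing.initList (machine c i o) x).stk := by
      funext k
      by_cases hk : k = ⟨i, by simp⟩
      · subst hk
        simp [Turing.initList, machine]
        rfl
      · have : k.1 ≠ i := fun h => hk (Subtype.ext h)
        simp [Turing.initList, machine, hk, this]
    rw [hi] at hv
    exact hv
  · have ho : (fun k : (insert i (insert o (keys c)) : Finset K) =>
        Function.update (fun _ => ([] : List Γ)) o y k.1) =
        (Turing.haltList (machine c i o) y).stk := by
      funext k
      by_cases hk : k = ⟨o, by simp⟩
      · subst hk
        simp [Turing.haltList, machine]
        rfl
      · have : k.1 ≠ o := fun h => hk (Subtype.ext h)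
        simp [Turing.haltList, machine, hk, this]
    exact congrArg (fun S => some (⟨none, none, S⟩ : (machine c i o).Cfg)) ho

/-! ### Time bounds and elementary stack programs -/

variable [DecidableEq K]

/-- `RunsIn c S S' T`: the program transforms the stacks `S` into `S'` in at most `T` steps. -/
def RunsIn (c : Cmd K Γ) (S S' : K → List Γ) (T : ℕ) : Prop := ∃ t ≤ T, Runs c S S' t

theorem RunsIn.seq {c d : Cmd K Γ} {S S₁ S₂ : K → List Γ} {T₁ T₂ : ℕ} (h₁ : RunsIn c S S₁ T₁)
    (h₂ : RunsIn d S₁ S₂ T₂) : RunsIn (seq c d) S S₂ (T₁ + T₂) := by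
  obtain ⟨t₁, ht₁, h₁⟩ := h₁
  obtain ⟨t₂, ht₂, h₂⟩ := h₂
  exact ⟨t₁ + t₂, by omega, h₁.seq h₂⟩

theorem RunsIn.mono {c : Cmd K Γ} {S S' : K → List Γ} {T T' : ℕ} (h : RunsIn c S S' T)
    (hT : T ≤ T') : RunsIn c S S' T' := by
  obtain ⟨t, ht, h⟩ := h
  exact ⟨t, ht.trans hT, h⟩

theorem RunsIn.congr {c : Cmd K Γ} {S S' S'' : K → List Γ} {T T' : ℕ} (h : RunsIn c S S' T)
    (hS : S' = S'') (hT : T ≤ T') : RunsIn c S S'' T' :=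
  hS ▸ h.mono hT

theorem RunsIn.case {k : K} {f : Option Γ → Cmd K Γ} {S S₁ : K → List Γ} {T : ℕ}
    (h : RunsIn (f (S k).head?) (Function.update S k (S k).tail) S₁ T) :
    RunsIn (case k f) S S₁ (1 + T) := by
  obtain ⟨t, ht, h⟩ := h
  exact ⟨1 + t, by omega, h.case⟩

theorem RunsIn.loop_cons {k : K} {f : Γ → Cmd K Γ} {S S₁ S₂ : K → List Γ} {a : Γ} {l : List Γ}
    {T₁ T₂ : ℕ} (h : S k = a :: l) (h₁ : RunsIn (f a) (Function.update S k l) S₁ T₁)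
    (h₂ : RunsIn (loop k f) S₁ S₂ T₂) : RunsIn (loop k f) S S₂ (1 + T₁ + T₂) := by
  obtain ⟨t₁, ht₁, h₁⟩ := h₁
  obtain ⟨t₂, ht₂, h₂⟩ := h₂
  exact ⟨1 + t₁ + t₂, by omega, .loop_cons h h₁ h₂⟩

theorem runsIn_skip (S : K → List Γ) : RunsIn skip S S 1 := ⟨1, le_rfl, .skip S⟩

theorem runsIn_push (k : K) (a : Γ) (S : K → List Γ) :
    RunsIn (push k a) S (Function.update S k (a :: S k)) 1 := ⟨1, le_rfl, .push k a S⟩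

theorem runsIn_loop_nil {k : K} {f : Γ → Cmd K Γ} {S : K → List Γ} (h : S k = []) :
    RunsIn (loop k f) S S 1 := ⟨1, le_rfl, .loop_nil h⟩

/-- Empty a stack. -/
def clear (a : K) : Cmd K Γ := loop a fun _ => skip

/-- Move the contents of a stack onto another one, in reverse order. -/
def move (a b : K) : Cmd K Γ := loop a fun x => push b x

/-- Move the contents of a stack onto two other ones, in reverse order. -/
def dup (a b c : K) : Cmd K Γ := loop a fun x => seq (push b x) (push c x)

/-- Write a word on a stack, in reverse order. -/
def write (a : K) : List Γ → Cmd K Γ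
  | [] => skip
  | x :: l => seq (push a x) (write a l)

theorem runsIn_clear (a : K) (S : K → List Γ) :
    RunsIn (clear a) S (Function.update S a []) (1 + 2 * (S a).length) := by
  induction hl : S a generalizing S with
  | nil =>
    rw [← hl, Function.update_eq_self]
    exact (runsIn_loop_nil hl).mono (by omega)
  | cons x l ih =>
    refine (RunsIn.loop_cons hl (runsIn_skip _) (ih _ (by simp))).congr ?_ ?_
    · simp
    · simp; omega

theorem runsIn_move {a b : K} (hab : a ≠ b) (S : K → List Γ) :
    RunsIn (move a b) S (Function.update (Function.update S a []) b ((S a).reverse ++ S b))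
      (1 + 2 * (S a).length) := by
  induction hl : S a generalizing S with
  | nil =>
    refine (runsIn_loop_nil hl).congr ?_ (by omega)
    rw [← hl, Function.update_eq_self, hl]
    simp
  | cons x l ih =>
    refine (RunsIn.loop_cons hl (runsIn_push _ _ _) (ih _ (by simp [hab]))).congr ?_ ?_
    · funext k
      grind [Function.update_apply]
    · simp; omega

theorem runsIn_dup {a b c : K} (hab : a ≠ b) (hac : a ≠ c) (hbc : b ≠ c) (S : K → List Γ) :
    RunsIn (dup a b c) S (Function.update (Function.update (Function.update S a [])
      b ((S a).reverse ++ S b)) c ((S a).reverse ++ S c)) (1 + 3 * (S a).length) := by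
  induction hl : S a generalizing S with
  | nil =>
    refine (runsIn_loop_nil hl).congr ?_ (by omega)
    funext k
    grind [Function.update_apply]
  | cons x l ih =>
    refine (RunsIn.loop_cons hl ((runsIn_push _ _ _).seq (runsIn_push _ _ _))
      (ih _ (by simp [hab, hac]))).congr ?_ ?_
    · funext k
      grind [Function.update_apply]
    · simp; omega

theorem runsIn_write (a : K) (l : List Γ) (S : K → List Γ) :
    RunsIn (write a l) S (Function.update S a (l.reverse ++ S a)) (1 + l.length) := by
  induction l generalizing S with
  | nil => exact (runsIn_skip S).congr (by simp) (by omega)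
  | cons x l ih => exact ((runsIn_push a x S).seq (ih _)).congr (by simp) (by simp; omega)

/-- Pop two stacks simultaneously, and leave a nonempty stack `c` if their contents differ. -/
def compare [DecidableEq Γ] (a b c : K) : Cmd K Γ :=
  seq (loop a fun x => case b fun y => if y = some x then skip else push c x) (move b c)

/-- The symbols that are left behind when two words are compared. -/
def mismatch [DecidableEq Γ] : List Γ → List Γ → List Γ → List Γ
  | acc, [], l₂ => l₂.reverse ++ acc
  | acc, x :: l₁, l₂ => mismatch (if l₂.head? = some x then acc else x :: acc) l₁ l₂.tail

/-- Symbols are only added to the accumulator: one for each position of `l₁` where `l₂` disagrees or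
has ended, and finally the surplus of `l₂`. -/
theorem mismatch_eq_nil [DecidableEq Γ] (acc l₁ l₂ : List Γ) :
    mismatch acc l₁ l₂ = [] ↔ acc = [] ∧ l₁ = l₂ := by
  induction l₁ generalizing acc l₂ with
  | nil =>
    rw [mismatch, List.append_eq_nil_iff, List.reverse_eq_nil_iff, and_comm, eq_comm (a := l₂)]
  | cons x l₁ ih =>
    rw [mismatch, ih]
    cases l₂ with
    | nil => simp
    | cons y l₂ =>
      by_cases h : y = x
      · simp [h]
      · simp [h, Ne.symm h]

theorem length_mismatch_le [DecidableEq Γ] (acc l₁ l₂ : List Γ) :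
    (mismatch acc l₁ l₂).length ≤ acc.length + l₁.length + l₂.length := by
  induction l₁ generalizing acc l₂ with
  | nil => simp [mismatch]; omega
  | cons x l₁ ih =>
    refine (ih _ _).trans ?_
    split_ifs <;> simp <;> omega

theorem runsIn_compare [DecidableEq Γ] {a b c : K} (hab : a ≠ b) (hac : a ≠ c) (hbc : b ≠ c)
    (S : K → List Γ) :
    RunsIn (compare a b c) S (Function.update (Function.update (Function.update S a []) b [])
      c (mismatch (S c) (S a) (S b))) (2 + 3 * (S a).length + 2 * (S b).length) := by
  -- After the loop alone, the surplus of the second word is still on `b`. In `mismatch` this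
  -- surplus lies on top, so the stack `c` holds `mismatch` with that many symbols dropped.
  have key : RunsIn (loop a fun x => case b fun y => if y = some x then skip else push c x) S
      (Function.update (Function.update (Function.update S a []) b ((S b).drop (S a).length))
      c ((mismatch (S c) (S a) (S b)).drop ((S b).length - (S a).length)))
      (1 + 3 * (S a).length) := by
    induction hl : S a generalizing S with
    | nil =>
      refine (runsIn_loop_nil hl).congr ?_ (by omega)
      funext k
      by_cases h₁ : k = c
      · subst h₁
        simp [mismatch]
      by_cases h₂ : k = b
      · subst h₂; simp [hbc]
      by_cases h₃ : k = a
      · subst h₃; simp [h₂, h₁, hl]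
      simp [h₁, h₂, h₃]
    | cons x l ih =>
      have h1 : RunsIn (if (S b).head? = some x then skip else push c x)
          (Function.update (Function.update S a l) b (S b).tail)
          (Function.update (Function.update (Function.update S a l) b (S b).tail) c
            (if (S b).head? = some x then S c else x :: S c)) 1 := by
        split_ifs with h
        · refine (runsIn_skip _).congr ?_ le_rfl
          funext k
          grind [Function.update_apply]
        · refine (runsIn_push _ _ _).congr ?_ le_rfl
          simp [Ne.symm hac, Ne.symm hbc]
      refine (RunsIn.loop_cons hl
        (RunsIn.case (by simpa [Ne.symm hab] using h1)) (ih _ (by simp [hab, hac]))).congr ?_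
        (by simp; omega)
      funext k
      by_cases h₁ : k = c
      · subst h₁
        simp only [Function.update_self, Function.update_of_ne hbc, mismatch]
        congr 1
        simp only [List.length_cons, List.length_tail]
        omega
      by_cases h₂ : k = b
      · subst h₂; simp [hbc]
      by_cases h₃ : k = a
      · subst h₃; simp [h₂, h₁]
      simp [h₁, h₂, h₃]
  refine (key.seq (runsIn_move hbc _)).congr ?_ ?_
  -- The closing `move` puts the surplus on top of `c` and thereby completes `mismatch`.
  · have hm : ∀ (l₁ l₂ acc : List Γ), (l₂.drop l₁.length).reverse ++
        (mismatch acc l₁ l₂).drop (l₂.length - l₁.length) = mismatch acc l₁ l₂ := by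
      intro l₁
      induction l₁ with
      | nil => intro l₂ acc; simp [mismatch]
      | cons x l₁ ih =>
        intro l₂ acc
        have := ih l₂.tail (if l₂.head? = some x then acc else x :: acc)
        rw [mismatch]
        convert this using 3
        · simp
        · simp only [List.length_cons, List.length_tail]
          omega
    funext k
    by_cases h₁ : k = c
    · subst h₁
      simp [hbc, hm]
    by_cases h₂ : k = b
    · subst h₂; simp [hbc]
    by_cases h₃ : k = a
    · subst h₃; simp [h₂, h₁]
    simp [h₁, h₂, h₃]
  · simp [hbc]; omega

end Cmd

/-! ### A language of polynomial time string functions -/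

/-- Expressions that denote words over `Γ`. In `loop d e₁ e₂` the value of `e₁` is cut after each
symbol that satisfies `d`, and the values of `e₂` for all pieces are concatenated; in `e₂` the first
two unused variables stand for the piece and for the rest of the word after it. -/
inductive Exp (Γ : Type) where
  | lit (l : List Γ) : Exp Γ
  | var (i : ℕ) : Exp Γ
  | append (e₁ e₂ : Exp Γ) : Exp Γ
  | loop (d : Γ → Bool) (e₁ e₂ : Exp Γ) : Exp Γ
  | ifEq (e₁ e₂ e₃ e₄ : Exp Γ) : Exp Γ

/-- The pieces of a word that end with a symbol satisfying `d`, each with the rest of the word. The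
first argument is a prefix that belongs to the first piece. -/
def pieces {Γ : Type} (d : Γ → Bool) : List Γ → List Γ → List (List Γ × List Γ)
  | _, [] => []
  | acc, a :: l => if d a then (acc ++ [a], l) :: pieces d [] l else pieces d (acc ++ [a]) l

theorem length_pieces_le {Γ : Type} (d : Γ → Bool) (acc l : List Γ) :
    (pieces d acc l).length ≤ l.length := by
  induction l generalizing acc with
  | nil => simp [pieces]
  | cons a l ih =>
    rw [pieces]
    split_ifs
    · simpa using ih _
    · exact (ih _).trans (by simp)

/-- A piece and the rest after it together form a suffix of `acc ++ l`. -/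
theorem length_le_of_mem_pieces {Γ : Type} {d : Γ → Bool} {acc l : List Γ} {x : List Γ × List Γ}
    (h : x ∈ pieces d acc l) : x.1.length + x.2.length ≤ acc.length + l.length := by
  induction l generalizing acc with
  | nil => simp [pieces] at h
  | cons a l ih =>
    rw [pieces] at h
    split_ifs at h
    · rcases List.mem_cons.1 h with rfl | h
      · simp; omega
      · have := ih h
        simp at this ⊢
        omega
    · have := ih h
      simp at this ⊢
      omega

/-- The environment in which the variables `p` and `p + 1` have been assigned. -/
def bindVars {Γ : Type} (ρ : ℕ → List Γ) (p : ℕ) (x : List Γ × List Γ) : ℕ → List Γ :=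
  Function.update (Function.update ρ p x.1) (p + 1) x.2

theorem length_bindVars_le {Γ : Type} {ρ : ℕ → List Γ} {N L : ℕ} (hρ : ∀ i, (ρ i).length ≤ N)
    {x : List Γ × List Γ} (hx : x.1.length + x.2.length ≤ L) (p i : ℕ) :
    (bindVars ρ p x i).length ≤ N + L := by
  have := hρ i
  rw [bindVars]
  simp only [Function.update_apply]
  split_ifs <;> omega

namespace Exp

variable {Γ : Type} [DecidableEq Γ]

/-- The value of an expression, where the variables from `p` on are unused. -/
def eval : Exp Γ → ℕ → (ℕ → List Γ) → List Γ
  | lit l, _, _ => l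
  | var i, _, ρ => ρ i
  | append e₁ e₂, p, ρ => eval e₁ p ρ ++ eval e₂ p ρ
  | loop d e₁ e₂, p, ρ =>
    (pieces d [] (eval e₁ p ρ)).flatMap fun x => eval e₂ (p + 2) (bindVars ρ p x)
  | ifEq e₁ e₂ e₃ e₄, p, ρ => if eval e₁ p ρ = eval e₂ p ρ then eval e₃ p ρ else eval e₄ p ρ

open Polynomial in
/-- A bound for the length of the value in terms of a bound for the lengths of the variables. -/
noncomputable def size : Exp Γ → Polynomial ℕ
  | lit l => C l.length
  | var _ => X
  | append e₁ e₂ => size e₁ + size e₂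
  | loop _ e₁ e₂ => size e₁ * (size e₂).comp (X + size e₁)
  | ifEq _ _ e₃ e₄ => size e₃ + size e₄

/-- A loop makes at most as many rounds as the value of `e₁` has symbols, and its two new variables
are parts of that value. So the body is evaluated under the bound `N + (size e₁).eval N`;
composition of polynomials accounts for nesting. -/
theorem length_eval_le (e : Exp Γ) (p : ℕ) {ρ : ℕ → List Γ} {N : ℕ}
    (hρ : ∀ i, (ρ i).length ≤ N) : (eval e p ρ).length ≤ (size e).eval N := by
  induction e generalizing p ρ N with
  | lit l => simp [eval, size]
  | var i => simpa [eval, size] using hρ i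
  | append e₁ e₂ ih₁ ih₂ => simpa [eval, size] using add_le_add (ih₁ p hρ) (ih₂ p hρ)
  | loop d e₁ e₂ ih₁ ih₂ =>
    have h₁ := ih₁ p hρ
    simp only [eval, size, Polynomial.eval_mul, Polynomial.eval_comp, Polynomial.eval_add,
      Polynomial.eval_X, List.length_flatMap]
    refine (List.sum_le_card_nsmul _ ((size e₂).eval (N + (size e₁).eval N)) ?_).trans ?_
    · simp only [List.mem_map, forall_exists_index, and_imp]
      rintro _ x hx rfl
      refine ih₂ _ (length_bindVars_le hρ ?_ p)
      have := length_le_of_mem_pieces hx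
      simp only [List.length_nil, zero_add] at this
      exact this.trans h₁
    · rw [smul_eq_mul, List.length_map]
      exact Nat.mul_le_mul_right _ ((length_pieces_le _ _ _).trans h₁)
  | ifEq e₁ e₂ e₃ e₄ ih₁ ih₂ ih₃ ih₄ =>
    have h₃ := ih₃ p hρ
    have h₄ := ih₄ p hρ
    simp only [eval, size, Polynomial.eval_add]
    split_ifs <;> omega

open Polynomial in
/-- A bound for the time needed to compute the value. -/
noncomputable def time : Exp Γ → Polynomial ℕ
  | lit l => C (1 + l.length)
  | var _ => 2 + 5 * X
  | append e₁ e₂ => time e₁ + time e₂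
  | loop _ e₁ e₂ => time e₁ + (3 + 4 * size e₁) +
      size e₁ * (7 + 11 * size e₁ + (time e₂).comp (X + size e₁))
  | ifEq e₁ e₂ e₃ e₄ => time e₁ + time e₂ + (4 + 5 * size e₁ + 4 * size e₂) + time e₃ + time e₄

/-! ### Compilation of expressions into stack programs -/

open Cmd

/-- The commands that prepare the variables for the next piece of the word in a loop. -/
def bindCmd (p n : ℕ) : Cmd (ℕ ⊕ ℕ) Γ :=
  (Cmd.move (.inr (n + 2)) (.inl p)).seq ((Cmd.move (.inr (n + 1)) (.inr n)).seq
    (Cmd.dup (.inr n) (.inr (n + 1)) (.inl (p + 1))))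

/-- The commands that release the variables of a loop. -/
def unbindCmd (p : ℕ) : Cmd (ℕ ⊕ ℕ) Γ :=
  (Cmd.clear (.inl p)).seq (Cmd.clear (.inl (p + 1)))

/-- The loop over all pieces of the word on the stack `n + 1`. -/
def loopCmd (d : Γ → Bool) (p n : ℕ) (body : Cmd (ℕ ⊕ ℕ) Γ) : Cmd (ℕ ⊕ ℕ) Γ :=
  .loop (.inr (n + 1)) fun a => (Cmd.push (.inr (n + 2)) a).seq
    (if d a then (bindCmd p n).seq (body.seq (unbindCmd p)) else .skip)

/-- The program that writes the value of an expression, in reverse order, on the stack `o`. The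
variables are kept on the stacks on the left, those from `p` on being empty; the stacks on the right
from `n` on are used for intermediate results. -/
def compile : Exp Γ → (p n o : ℕ) → Cmd (ℕ ⊕ ℕ) Γ
  | lit l, _, _, o => Cmd.write (.inr o) l
  | var i, _, n, o => (Cmd.dup (.inl i) (.inr n) (.inr o)).seq (Cmd.move (.inr n) (.inl i))
  | append e₁ e₂, p, n, o => (compile e₁ p n o).seq (compile e₂ p n o)
  | loop d e₁ e₂, p, n, o =>
    (compile e₁ p (n + 3) n).seq ((Cmd.move (.inr n) (.inr (n + 1))).seq
      ((loopCmd d p n (compile e₂ (p + 2) (n + 3) o)).seq (Cmd.clear (.inr (n + 2)))))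
  | ifEq e₁ e₂ e₃ e₄, p, n, o =>
    (((compile e₁ p (n + 3) n).seq (compile e₂ p (n + 3) (n + 1))).seq
      (Cmd.compare (.inr n) (.inr (n + 1)) (.inr (n + 2)))).seq
        (Cmd.case (.inr (n + 2)) fun a =>
          match a with
          | none => compile e₃ p (n + 3) o
          | some _ => (Cmd.clear (.inr (n + 2))).seq (compile e₄ p (n + 3) o))

/-- The stacks hold the variables, and those reserved for intermediate results are empty. -/
structure Ready (ρ : ℕ → List Γ) (p n : ℕ) (S : ℕ ⊕ ℕ → List Γ) : Prop where
  var : ∀ i, S (.inl i) = ρ i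
  unused : ∀ i, p ≤ i → ρ i = []
  tmp : ∀ m, n ≤ m → S (.inr m) = []

omit [DecidableEq Γ] in
theorem Ready.update {ρ : ℕ → List Γ} {p n n' : ℕ} {S : ℕ ⊕ ℕ → List Γ} (h : Ready ρ p n S)
    (hn : n ≤ n') {o : ℕ} (ho : o < n') (l : List Γ) :
    Ready ρ p n' (Function.update S (.inr o) l) where
  var i := by simp [h.var]
  unused := h.unused
  tmp m hm := by
    rw [Function.update_of_ne (by simp; omega)]
    exact h.tmp m (hn.trans hm)

-- The piece was collected in reverse order, so one move puts it right. The rest of the word is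
-- needed for the following pieces too: it is moved away and duplicated back, and the two reversals
-- cancel.
omit [DecidableEq Γ] in
theorem runsIn_bindCmd (p n : ℕ) (S : ℕ ⊕ ℕ → List Γ) (h₁ : S (.inr n) = [])
    (h₂ : S (.inl p) = []) (h₃ : S (.inl (p + 1)) = []) :
    RunsIn (bindCmd p n) S (Function.update (Function.update (Function.update S
      (.inl p) (S (.inr (n + 2))).reverse) (.inl (p + 1)) (S (.inr (n + 1)))) (.inr (n + 2)) [])
      (3 + 2 * (S (.inr (n + 2))).length + 5 * (S (.inr (n + 1))).length) := by
  have e₁ := runsIn_move (a := Sum.inr (n + 2)) (b := Sum.inl p) (by simp) S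
  refine (e₁.seq ((runsIn_move (by simp) _).seq
    (runsIn_dup (by simp) (by simp) (by simp) _))).congr ?_ ?_
  · funext k
    simp only [Function.update_apply, Sum.inr.injEq, Sum.inl.injEq, reduceCtorEq, if_false,
      Nat.add_right_cancel_iff, if_true, h₁, h₂, h₃]
    rcases k with i | m
    · simp
    · simp
      grind
  · simp [h₁]; omega

/-- The induction runs over the unread word on the stack `n + 1`, while `acc` is the unfinished
piece, kept reversed on `n + 2`. A symbol that completes a piece costs at most `2` steps for popping
and pushing, `3 + 5 * L` for binding, `T` for the body and `2 + 2 * L` for releasing, well within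
the bound. -/
theorem runsIn_loopCmd (d : Γ → Bool) {ρ : ℕ → List Γ} {p n o : ℕ} (ho : o < n)
    (F : List Γ × List Γ → List Γ) (body : Cmd (ℕ ⊕ ℕ) Γ) {L T : ℕ}
    (hbody : ∀ x : List Γ × List Γ, x.1.length + x.2.length ≤ L → ∀ S,
      Ready (bindVars ρ p x) (p + 2) (n + 3) S →
      RunsIn body S (Function.update S (.inr o) ((F x).reverse ++ S (.inr o))) T)
    (l acc : List Γ) (hl : acc.length + l.length ≤ L) (S : ℕ ⊕ ℕ → List Γ)
    (hS : Ready ρ p (n + 3) S) (h₀ : S (.inr n) = []) (h₁ : S (.inr (n + 1)) = l)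
    (h₂ : S (.inr (n + 2)) = acc.reverse) :
    ∃ r : List Γ, r.length ≤ L ∧ RunsIn (loopCmd d p n body) S
      (Function.update (Function.update (Function.update S (.inr (n + 1)) []) (.inr (n + 2)) r)
        (.inr o) (((pieces d acc l).flatMap F).reverse ++ S (.inr o)))
      (1 + l.length * (7 + 11 * L + T)) := by
  induction l generalizing acc S with
  | nil =>
    -- Symbols after the last delimiter form no piece; they are left on the stack `n + 2` and
    -- cleared by the caller.
    refine ⟨acc.reverse, by simpa using hl, (runsIn_loop_nil h₁).congr ?_ (by omega)⟩
    funext k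
    grind [Function.update_apply, pieces]
  | cons a l ih =>
    by_cases hd : d a
    · have hlen : (acc ++ [a]).length + l.length ≤ L := by simp at hl ⊢; omega
      -- The stacks after the delimiter is pushed, the variables are bound, the body is run and the
      -- variables are released, in this order.
      set S₁ := Function.update (Function.update S (.inr (n + 1)) l) (.inr (n + 2))
        (a :: acc.reverse) with hS₁
      set S₂ := Function.update (Function.update (Function.update S₁ (.inl p) (acc ++ [a]))
        (.inl (p + 1)) l) (.inr (n + 2)) [] with hS₂
      set S₃ := Function.update S₂ (.inr o) ((F (acc ++ [a], l)).reverse ++ S (.inr o)) with hS₃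
      set S₄ := Function.update (Function.update (Function.update S (.inr (n + 1)) l)
        (.inr (n + 2)) []) (.inr o) ((F (acc ++ [a], l)).reverse ++ S (.inr o)) with hS₄
      have r₁ : RunsIn (Cmd.push (.inr (n + 2)) a) (Function.update S (.inr (n + 1)) l) S₁ 1 :=
        (runsIn_push _ _ _).congr (by rw [hS₁]; simp [h₂]) le_rfl
      have r₂ : RunsIn (bindCmd p n) S₁ S₂ (3 + 5 * L) := by
        refine (runsIn_bindCmd p n S₁ (by simp [hS₁, h₀])
          (by simp [hS₁, hS.var, hS.unused]) (by simp [hS₁, hS.var, hS.unused])).congr ?_ ?_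
        · simp [hS₁, hS₂]
        · simp [hS₁] at hl ⊢; omega
      have r₃ : RunsIn body S₂ S₃ T := by
        refine (hbody (acc ++ [a], l) hlen S₂ ⟨?_, ?_, ?_⟩).congr ?_ le_rfl
        · intro i
          simp only [hS₂, hS₁, bindVars, Function.update_apply, Sum.inl.injEq, reduceCtorEq,
            if_false, hS.var]
        · intro i hi
          rw [bindVars, Function.update_of_ne (by omega), Function.update_of_ne (by omega)]
          exact hS.unused i (by omega)
        · intro m hm
          have := hS.tmp m hm
          simp only [hS₂, hS₁, Function.update_apply, Sum.inr.injEq, reduceCtorEq,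
            if_false, this]
          split_ifs <;> first | rfl | omega
        · rw [hS₃]
          congr 2
          simp only [hS₂, hS₁, Function.update_apply, Sum.inr.injEq, reduceCtorEq, if_false]
          split_ifs <;> first | rfl | omega
      have r₄ : RunsIn (unbindCmd p) S₃ S₄ (2 + 2 * L) := by
        refine ((runsIn_clear _ _).seq (runsIn_clear _ _)).congr ?_ ?_
        · funext k
          rcases k with i | m
          · simp only [hS₄, hS₃, hS₂, hS₁, Function.update_apply, Sum.inl.injEq, reduceCtorEq,
              if_false, hS.var]
            have := hS.unused i
            split_ifs <;> first | rfl | (exact (this (by omega)).symm)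
          · simp only [hS₄, hS₃, hS₂, hS₁, Function.update_apply, Sum.inr.injEq, reduceCtorEq,
              if_false]
            split_ifs <;> rfl
        · simp [hS₃, hS₂] at hl ⊢; omega
      obtain ⟨r, hr, h⟩ := ih [] (by simp at hl ⊢; omega) S₄
        ((((hS.update le_rfl (by omega) l).update le_rfl (by omega) [])).update le_rfl
          (by omega) _)
        (by simp [hS₄, h₀, show n ≠ o by omega]) (by simp [hS₄, show n + 1 ≠ o by omega])
        (by simp [hS₄, show n + 2 ≠ o by omega])
      have r₅ : RunsIn (if d a = true then (bindCmd p n).seq (body.seq (unbindCmd p)) else .skip)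
          S₁ S₄ ((3 + 5 * L) + (T + (2 + 2 * L))) := by
        simp only [hd, if_true]
        exact r₂.seq (r₃.seq r₄)
      refine ⟨r, hr, (RunsIn.loop_cons h₁ (r₁.seq r₅) h).congr ?_ ?_⟩
      · funext k
        simp only [hS₄, pieces, hd, if_true, List.flatMap_cons, List.reverse_append,
          Function.update_self]
        grind [Function.update_apply]
      · simp only [List.length_cons, Nat.add_mul]
        omega
    · obtain ⟨r, hr, h⟩ := ih (acc ++ [a]) (by simp at hl ⊢; omega)
        (Function.update (Function.update S (.inr (n + 1)) l) (.inr (n + 2)) (a :: acc.reverse))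
        ((hS.update le_rfl (by omega) l).update le_rfl (by omega) _) (by simp [h₀]) (by simp)
        (by simp)
      have r₅ : RunsIn (if d a = true then (bindCmd p n).seq (body.seq (unbindCmd p)) else .skip)
          (Function.update (Function.update S (.inr (n + 1)) l) (.inr (n + 2)) (a :: acc.reverse))
          (Function.update (Function.update S (.inr (n + 1)) l) (.inr (n + 2)) (a :: acc.reverse))
          1 := by
        simp only [hd]
        exact runsIn_skip _
      refine ⟨r, hr, (RunsIn.loop_cons h₁
        (((runsIn_push _ _ _).congr (by simp [h₂]) le_rfl).seq r₅) h).congr ?_ ?_⟩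
      · funext k
        simp only [pieces, hd]
        grind [Function.update_apply]
      · simp only [List.length_cons, Nat.add_mul]
        omega

/-- Writing every value in reverse order on top of `o` makes concatenation free: the second value is
just written after the first. Loops and comparisons keep the stacks `n`, `n + 1`, `n + 2` for
themselves and pass `n + 3` on to their subexpressions. -/
theorem runsIn_compile (e : Exp Γ) {ρ : ℕ → List Γ} {p n o : ℕ} {S : ℕ ⊕ ℕ → List Γ}
    (hS : Ready ρ p n S) (ho : o < n) {N : ℕ} (hρ : ∀ i, (ρ i).length ≤ N) :
    RunsIn (compile e p n o) S (Function.update S (.inr o) ((eval e p ρ).reverse ++ S (.inr o)))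
      ((time e).eval N) := by
  induction e generalizing ρ p n o S N with
  | lit l => exact (runsIn_write _ _ _).congr rfl (by simp [time])
  | var i =>
    -- Reading a variable empties its stack; the second copy on `n` is there to restore it.
    refine ((runsIn_dup (by simp) (by simp) (by simp; omega) _).seq
      (runsIn_move (by simp) _)).congr ?_ ?_
    · have hn := hS.tmp n le_rfl
      have hi := hS.var i
      funext k
      simp only [eval, ← hi]
      rcases k with j | m
      · simp only [Function.update_apply, Sum.inl.injEq, reduceCtorEq, if_false]
        grind
      · simp only [Function.update_apply, Sum.inr.injEq, reduceCtorEq, if_false]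
        grind
    · have := hρ i
      have hn := hS.tmp n le_rfl
      simp [time, hS.var, hn, show n ≠ o by omega]
      omega
  | append e₁ e₂ ih₁ ih₂ =>
    refine ((ih₁ hS ho hρ).seq (ih₂ (hS.update le_rfl ho _) ho hρ)).congr ?_ ?_
    · simp [eval]
    · simp [time]
  | loop d e₁ e₂ ih₁ ih₂ =>
    have hL := length_eval_le e₁ p hρ
    set L := (size e₁).eval N
    set u := eval e₁ p ρ with hu
    have r₁ := ih₁ (n := n + 3) (o := n) (S := S) ⟨hS.var, hS.unused, fun m hm =>
      hS.tmp m (by omega)⟩ (by omega) hρ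
    -- The value of `e₁` arrives reversed on `n`; this move brings it into reading order for the
    -- loop.
    have r₂ : RunsIn (Cmd.move (.inr n) (.inr (n + 1))) (Function.update S (.inr n)
        (u.reverse ++ S (.inr n))) (Function.update S (.inr (n + 1)) u) (1 + 2 * L) := by
      have h₀ := hS.tmp n le_rfl
      have h₁ := hS.tmp (n + 1) (by omega)
      refine (runsIn_move (by simp) _).congr ?_ ?_
      · funext k
        simp [h₀, h₁]
        grind [Function.update_apply]
      · simp [h₀]; omega
    obtain ⟨r, hr, r₃⟩ := runsIn_loopCmd d ho (fun x => eval e₂ (p + 2) (bindVars ρ p x))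
      (compile e₂ (p + 2) (n + 3) o) (L := L) (T := (time e₂).eval (N + L))
      (fun x hx S hS => ih₂ hS (by omega) (length_bindVars_le hρ hx p)) u [] (by simpa using hL)
      (Function.update S (.inr (n + 1)) u) (hS.update (by omega) (by omega) _)
      (by simp [hS.tmp]) (by simp) (by simp [hS.tmp])
    refine (r₁.seq (r₂.seq (r₃.seq (runsIn_clear _ _)))).congr ?_ ?_
    · have h₁ := hS.tmp (n + 1) (by omega)
      have h₂ := hS.tmp (n + 2) (by omega)
      funext k
      simp only [eval, ← hu]
      grind [Function.update_apply]
    · have hmul := Nat.mul_le_mul_right (7 + 11 * L + (time e₂).eval (N + L)) hL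
      simp only [time, Polynomial.eval_add, Polynomial.eval_mul, Polynomial.eval_comp,
        Polynomial.eval_X, Polynomial.eval_ofNat]
      rw [Function.update_of_ne (by simp; omega), Function.update_self]
      change _ ≤ _ + (3 + 4 * L) + L * (7 + 11 * L + (time e₂).eval (N + L))
      omega
  | ifEq e₁ e₂ e₃ e₄ ih₁ ih₂ ih₃ ih₄ =>
    have hL₁ := length_eval_le e₁ p hρ
    have hL₂ := length_eval_le e₂ p hρ
    set u := eval e₁ p ρ with hu
    set v := eval e₂ p ρ with hv
    have h₀ := hS.tmp n le_rfl
    have h₁ := hS.tmp (n + 1) (by omega)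
    have h₂ := hS.tmp (n + 2) (by omega)
    have hS3 : Ready ρ p (n + 3) S := ⟨hS.var, hS.unused, fun m hm => hS.tmp m (by omega)⟩
    have r₁ := ih₁ (n := n + 3) (o := n) hS3 (by omega) hρ
    have r₂ := ih₂ (n := n + 3) (o := n + 1) (hS3.update le_rfl (o := n) (by omega)
      (u.reverse ++ S (.inr n))) (by omega) hρ
    -- The words are compared in reversed form, which does not affect equality.
    set D := mismatch [] u.reverse v.reverse with hD
    have r₃ := ((r₁.seq r₂).seq (runsIn_compare (a := Sum.inr n) (b := .inr (n + 1))
      (c := .inr (n + 2)) (by simp) (by simp) (by simp) _)).congr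
      (S'' := Function.update S (Sum.inr (n + 2)) D)
      (T' := (time e₁).eval N + (time e₂).eval N + (2 + 3 * u.length + 2 * v.length))
      (by
        funext k
        simp only [Function.update_apply, Sum.inr.injEq, h₀, h₁, h₂]
        grind) (by simp [h₀, h₁, hu, hv])
    have hDl : D.length ≤ u.length + v.length := by
      simpa using length_mismatch_le [] u.reverse v.reverse
    have hDn : D = [] ↔ u = v := by
      rw [hD, mismatch_eq_nil]
      simp
    by_cases huv : u = v
    · have hD0 := hDn.2 huv
      refine (r₃.seq (RunsIn.case (T := (time e₃).eval N)
        (S₁ := Function.update S (.inr o) ((eval e₃ p ρ).reverse ++ S (.inr o))) ?_)).congr ?_ ?_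
      · have hSD : Function.update S (Sum.inr (n + 2)) D = S := by
          rw [hD0, ← h₂, Function.update_eq_self]
        simp only [hSD, h₂, List.head?_nil, List.tail_nil]
        convert ih₃ hS3 (o := o) (by omega) hρ using 1
        rw [← h₂, Function.update_eq_self]
      · simp only [eval, ← hu, ← hv, if_pos huv]
      · simp only [time, Polynomial.eval_add, Polynomial.eval_mul, Polynomial.eval_ofNat]
        omega
    · have hD0 : D ≠ [] := fun h => huv (hDn.1 h)
      obtain ⟨x, D', hxD⟩ := List.exists_cons_of_ne_nil hD0
      refine (r₃.seq (RunsIn.case (T := 1 + 2 * D.length + (time e₄).eval N)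
        (S₁ := Function.update S (.inr o) ((eval e₄ p ρ).reverse ++ S (.inr o))) ?_)).congr ?_ ?_
      · simp only [hxD, Function.update_self, List.head?_cons, List.tail_cons,
          Function.update_idem]
        have hSD : Function.update (Function.update S (Sum.inr (n + 2)) D') (.inr (n + 2)) [] =
            S := by
          rw [Function.update_idem, ← h₂, Function.update_eq_self]
        have hc := runsIn_clear (Sum.inr (n + 2)) (Function.update S (Sum.inr (n + 2)) D')
        rw [hSD, Function.update_self] at hc
        exact (hc.seq (ih₄ hS3 (o := o) (by omega) hρ)).congr rfl (by simp)
      · simp only [eval, ← hu, ← hv, if_neg huv]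
      · simp only [time, Polynomial.eval_add, Polynomial.eval_mul, Polynomial.eval_ofNat]
        omega

/-- The value of an expression as a function of its first variable. -/
def apply (e : Exp Γ) (x : List Γ) : List Γ :=
  eval e 1 (Function.update (fun _ => []) 0 x)

/-- The constant is the sum of the coefficients and the exponent is the degree. The base `n + 1` is
positive, so its powers increase with the exponent even for `n = 0`. -/
theorem exists_eval_le_pow (P : Polynomial ℕ) :
    ∃ C d : ℕ, ∀ n, P.eval n ≤ C * (n + 1) ^ d := by
  refine ⟨∑ i ∈ Finset.range (P.natDegree + 1), P.coeff i, P.natDegree, fun n => ?_⟩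
  rw [Polynomial.eval_eq_sum_range, Finset.sum_mul]
  refine Finset.sum_le_sum fun i hi => Nat.mul_le_mul_left _ ?_
  exact (Nat.pow_le_pow_left n.le_succ i).trans
    (Nat.pow_le_pow_right n.succ_pos (Nat.lt_succ_iff.1 (Finset.mem_range.1 hi)))

/-- The values of expressions are computable in polynomial time by stack machines. -/
theorem exists_machine [Fintype Γ] (e : Exp Γ) :
    ∃ (c : Cmd (ℕ ⊕ ℕ) Γ) (i o : ℕ ⊕ ℕ) (C d : ℕ), ∀ x : List Γ,
      Nonempty (Turing.TM2OutputsInTime (c.machine i o) x (some (e.apply x))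
        (C * (x.length + 1) ^ d)) := by
  -- The summands pay for the compiled expression, for moving the reversed value to the output
  -- stack, for clearing the input stack and for halting.
  obtain ⟨C, d, h⟩ := exists_eval_le_pow
    (time e + (1 + 2 * size e + (1 + 2 * Polynomial.X) + 1))
  refine ⟨(compile e 1 1 0).seq ((Cmd.move (.inr 0) (.inr 1)).seq (Cmd.clear (.inl 0))),
    .inl 0, .inr 1, C, d, fun x => ?_⟩
  have hρ : ∀ i, (Function.update (fun _ => ([] : List Γ)) 0 x i).length ≤ x.length := by
    intro i
    rw [Function.update_apply]
    split_ifs <;> simp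
  have hsize := length_eval_le e 1 hρ
  have r₁ := runsIn_compile e (p := 1) (n := 1) (o := 0)
    (S := Function.update (fun _ => []) (.inl 0) x)
    (ρ := Function.update (fun _ => []) 0 x)
    ⟨fun i => by simp [Function.update_apply], fun i hi => by
      rw [Function.update_of_ne (by omega)], fun m _ => by simp⟩ one_pos hρ
  have r₂ := (r₁.seq ((runsIn_move (a := Sum.inr 0) (b := Sum.inr 1) (by simp) _).seq
    (runsIn_clear (.inl 0) _))).congr
    (S'' := Function.update (fun _ => []) (.inr 1) (e.apply x))
    (T' := (time e).eval x.length + (1 + 2 * (size e).eval x.length + (1 + 2 * x.length)))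
    (by
      funext k
      simp only [Function.update_apply, apply]
      grind)
    (by simp; omega)
  obtain ⟨t, ht, r⟩ := r₂
  refine r.outputs (le_trans ?_ (h _))
  simp only [Polynomial.eval_add, Polynomial.eval_mul, Polynomial.eval_ofNat, Polynomial.eval_one,
    Polynomial.eval_X]
  omega

end Exp

end StackProgram

/-! ### Erasing triangles and inferring sentences -/

namespace ParamMorse

namespace Complex2

variable {V : Type}

theorem finite_triangles (D : Complex2 V) : D.triangles.Finite :=
  D.finite_faces.subset fun _ h => h.1

theorem ext_faces {D D' : Complex2 V} (h : D.faces = D'.faces) : D = D' := by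
  obtain ⟨⟨f, hf⟩, h₁, h₂⟩ := D
  obtain ⟨⟨f', hf'⟩, h₁', h₂'⟩ := D'
  obtain rfl : f = f' := h
  rfl

theorem triangles_removeTriangles (D : Complex2 V) (X : Set (Finset V)) :
    (D.removeTriangles X).triangles = D.triangles \ X := by
  ext t
  simp only [triangles, removeTriangles, Set.mem_ofPred_eq, Set.mem_sdiff]
  tauto

theorem edges_removeTriangles (D : Complex2 V) (X : Set (Finset V)) :
    (D.removeTriangles X).edges = D.edges := by
  ext e
  simp only [edges, removeTriangles, Set.mem_ofPred_eq]
  constructor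
  · rintro ⟨⟨h₁, -⟩, h₂⟩
    exact ⟨h₁, h₂⟩
  · rintro ⟨h₁, h₂⟩
    exact ⟨⟨h₁, by omega⟩, h₂⟩

theorem removeTriangles_removeTriangles (D : Complex2 V) (X Y : Set (Finset V)) :
    (D.removeTriangles X).removeTriangles Y = D.removeTriangles (X ∪ Y) := by
  apply ext_faces
  ext s
  simp only [removeTriangles, Set.mem_ofPred_eq, Set.mem_union]
  tauto

/-! ### Rounds of simultaneous erasure -/

/-- The triangles that lie in `X` or become external when the triangles in `X` are removed. -/
def spread (D : Complex2 V) (X : Set (Finset V)) : Set (Finset V) :=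
  {t | t ∈ D.triangles ∧
    (t ∈ X ∨ ∃ e ∈ D.edges, e ⊆ t ∧ ∀ t' ∈ D.triangles, e ⊆ t' → t' ≠ t → t' ∈ X)}

/-- This is the reason why erasing in a different order, or in parallel, cannot get stuck earlier.
-/
theorem spread_mono (D : Complex2 V) : Monotone D.spread := by
  rintro X Y h t ⟨ht, h' | ⟨e, he, het, h'⟩⟩
  · exact ⟨ht, Or.inl (h h')⟩
  · exact ⟨ht, Or.inr ⟨e, he, het, fun t' h₁ h₂ h₃ => h (h' t' h₁ h₂ h₃)⟩⟩

theorem spread_subset (D : Complex2 V) (X : Set (Finset V)) : D.spread X ⊆ D.triangles :=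
  fun _ h => h.1

theorem subset_spread (D : Complex2 V) {X : Set (Finset V)} (hX : X ⊆ D.triangles) :
    X ⊆ D.spread X := fun _ h => ⟨hX h, Or.inl h⟩

theorem spread_triangles (D : Complex2 V) : D.spread D.triangles = D.triangles :=
  (D.spread_subset _).antisymm (D.subset_spread subset_rfl)

theorem iterate_spread_subset (D : Complex2 V) {X : Set (Finset V)} (hX : X ⊆ D.triangles)
    (n : ℕ) : D.spread^[n] X ⊆ D.triangles := by
  cases n with
  | zero => exact hX
  | succ n =>
    rw [Function.iterate_succ_apply']
    exact D.spread_subset _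

/-- Edges survive the removal of triangles, so being external depends only on which triangles are
left. -/
theorem isExternal_removeTriangles_iff (D : Complex2 V) {X : Set (Finset V)}
    {t : Finset V} :
    (D.removeTriangles X).IsExternal t ↔ t ∈ D.spread X \ X := by
  simp only [IsExternal, triangles_removeTriangles, edges_removeTriangles, spread, Set.mem_sdiff,
    Set.mem_ofPred_eq]
  constructor
  · rintro ⟨⟨h₁, h₂⟩, e, he, het, h⟩
    exact ⟨⟨h₁, Or.inr ⟨e, he, het, fun t' h₃ h₄ h₅ => by
      by_contra h₆
      exact h₅ (h t' ⟨h₃, h₆⟩ h₄)⟩⟩, h₂⟩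
  · rintro ⟨⟨h₁, h | ⟨e, he, het, h⟩⟩, h₂⟩
    · exact absurd h h₂
    · refine ⟨⟨h₁, h₂⟩, e, he, het, ?_⟩
      rintro t' ⟨h₃, h₄⟩ h₅
      by_contra h₆
      exact h₄ (h t' h₃ h₅ h₆)

/-- Induction on the number of triangles outside `X`. If `spread X ⊆ X`, then monotonicity keeps all
iterates from `C` inside `X`, so nothing is left to erase. Otherwise some triangle in `spread X \ X`
is external, and erasing it enlarges `X`. -/
theorem isErasable_of_iterate_spread (D : Complex2 V) {C : Set (Finset V)} {n : ℕ}
    (hC : D.spread^[n] C = D.triangles) (X : Set (Finset V)) (hCX : C ⊆ X)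
    (hX : X ⊆ D.triangles) : (D.removeTriangles X).IsErasable := by
  induction hm : (D.triangles \ X).ncard using Nat.strong_induction_on generalizing X with
  | _ m ih =>
    by_cases hall : D.triangles ⊆ X
    · refine ⟨_, Relation.ReflTransGen.refl, ?_⟩
      rw [triangles_removeTriangles, Set.sdiff_eq_empty.2 hall]
    · obtain ⟨t, ht⟩ : (D.spread X \ X).Nonempty := by
        rw [Set.nonempty_iff_ne_empty, Ne, Set.sdiff_eq_empty]
        intro h
        refine hall (hC ▸ ?_)
        have : ∀ j, D.spread^[j] C ⊆ X := by
          intro j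
          induction j with
          | zero => exact hCX
          | succ j ihj =>
            rw [Function.iterate_succ_apply']
            exact (D.spread_mono ihj).trans h
        exact this n
      have hsub : X ∪ {t} ⊆ D.triangles :=
        Set.union_subset hX (Set.singleton_subset_iff.2 (D.spread_subset _ ht.1))
      obtain ⟨D', h₁, h₂⟩ := ih _ (by
        rw [← hm]
        refine Set.ncard_lt_ncard ?_ (D.finite_triangles.sdiff)
        refine ⟨Set.sdiff_subset_sdiff_right Set.subset_union_left, fun h => ?_⟩
        exact (h ⟨D.spread_subset _ ht.1, ht.2⟩).2 (Or.inr rfl))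
        (X ∪ {t}) (hCX.trans Set.subset_union_left) hsub rfl
      refine ⟨D', Relation.ReflTransGen.head ⟨t, D.isExternal_removeTriangles_iff.2 ht, ?_⟩ h₁, h₂⟩
      rw [removeTriangles_removeTriangles]

theorem isErasable_removeTriangles_iff (D : Complex2 V) {C : Set (Finset V)}
    (hC : C ⊆ D.triangles) :
    (D.removeTriangles C).IsErasable ↔ ∃ n, D.spread^[n] C = D.triangles := by
  refine ⟨?_, fun ⟨n, hn⟩ => D.isErasable_of_iterate_spread hn C subset_rfl hC⟩
  rintro ⟨D', h, hD'⟩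
  -- A triangle erased in one step enters in at most one further round, since the triangles erased
  -- before it are already in the current iterate.
  have key : ∃ X : Set (Finset V), D' = D.removeTriangles X ∧ ∃ n, X ⊆ D.spread^[n] C := by
    clear hD'
    induction h with
    | refl => exact ⟨C, rfl, 0, subset_rfl⟩
    | @tail D₁ D₂ _ hstep ih =>
      obtain ⟨X, rfl, n, hn⟩ := ih
      obtain ⟨t, ht, rfl⟩ := hstep
      have ht' := (D.isExternal_removeTriangles_iff.1 ht).1
      refine ⟨X ∪ {t}, removeTriangles_removeTriangles _ _ _, n + 1, ?_⟩
      rw [Function.iterate_succ_apply']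
      exact Set.union_subset (hn.trans (D.subset_spread (D.iterate_spread_subset hC n)))
        (Set.singleton_subset_iff.2 (D.spread_mono hn ht'))
  obtain ⟨X, rfl, n, hn⟩ := key
  rw [triangles_removeTriangles, Set.sdiff_eq_empty] at hD'
  exact ⟨n, (D.iterate_spread_subset hC n).antisymm (hD'.trans hn)⟩

theorem iterate_spread_eq_of_le (D : Complex2 V) {C : Set (Finset V)} {n N : ℕ} (hnN : n ≤ N)
    (h : D.spread^[n] C = D.triangles) : D.spread^[N] C = D.triangles := by
  induction N, hnN using Nat.le_induction with
  | base => exact h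
  | succ N _ ih => rw [Function.iterate_succ_apply', ih, spread_triangles]

/-- As long as the iterates change, each round adds at least one triangle. Once a round changes
nothing, all later iterates coincide; as one of them contains every triangle, so does the present
one. -/
theorem iterate_spread_eq_triangles (D : Complex2 V) {C : Set (Finset V)}
    (hC : C ⊆ D.triangles) {n N : ℕ} (h : D.spread^[n] C = D.triangles)
    (hN : D.triangles.ncard ≤ N) : D.spread^[N] C = D.triangles := by
  have key : ∀ j, D.spread^[j] C = D.triangles ∨ j ≤ (D.spread^[j] C).ncard := by
    intro j
    induction j with
    | zero => exact Or.inr (Nat.zero_le _)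
    | succ j ih =>
      rcases ih with ih | ih
      · exact Or.inl (D.iterate_spread_eq_of_le j.le_succ ih)
      · by_cases hj : D.spread^[j + 1] C = D.spread^[j] C
        · left
          have hconst : ∀ i, D.spread^[i + j] C = D.spread^[j] C := by
            intro i
            induction i with
            | zero => rw [Nat.zero_add]
            | succ i ihi =>
              rw [Nat.add_right_comm, Function.iterate_succ_apply', ihi,
                ← Function.iterate_succ_apply' D.spread, hj]
          have := D.iterate_spread_eq_of_le (Nat.le_add_right n j) h
          rw [hj, ← hconst n, this]
        · right
          have hsub : D.spread^[j] C ⊆ D.spread^[j + 1] C := by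
            rw [Function.iterate_succ_apply']
            exact D.subset_spread (D.iterate_spread_subset hC j)
          exact ih.trans_lt (Set.ncard_lt_ncard (hsub.ssubset_of_ne (Ne.symm hj))
            (D.finite_triangles.subset (D.iterate_spread_subset hC _)))
  rcases key N with h | h
  · exact h
  · exact Set.eq_of_subset_of_ncard_le (D.iterate_spread_subset hC N) (hN.trans h)
      D.finite_triangles

theorem er_le_iff (D : Complex2 V) (k : ℕ) : D.er ≤ k ↔
    ∃ C : Finset (Finset V), (C : Set (Finset V)) ⊆ D.triangles ∧ C.card ≤ k ∧
      ∃ n, D.spread^[n] (C : Set (Finset V)) = D.triangles := by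
  constructor
  · intro h
    -- An infimum over the empty set would be `0`; it is attained because all triangles may be
    -- removed.
    have hne : {n | ∃ C : Finset (Finset V), (C : Set (Finset V)) ⊆ D.triangles ∧ C.card = n ∧
        (D.removeTriangles C).IsErasable}.Nonempty := by
      have hall : (D.removeTriangles (D.finite_triangles.toFinset : Set (Finset V))).triangles =
          ∅ := by simp [triangles_removeTriangles]
      exact ⟨D.finite_triangles.toFinset.card, D.finite_triangles.toFinset, by simp, rfl, _,
        Relation.ReflTransGen.refl, hall⟩
    obtain ⟨C, h₁, h₂, h₃⟩ := Nat.sInf_mem hne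
    exact ⟨C, h₁, h₂.le.trans h, (D.isErasable_removeTriangles_iff h₁).1 h₃⟩
  · rintro ⟨C, h₁, h₂, h₃⟩
    refine le_trans ?_ h₂
    exact Nat.sInf_le ⟨C, h₁, rfl, (D.isErasable_removeTriangles_iff h₁).2 h₃⟩

end Complex2

/-- In the system of the edge stars, inference corresponds to erasing triangles. -/
theorem infer_image {V α : Type} {D : Complex2 V} {A : AxiomSystem α} {σ : Finset V → α}
    (hσ : Set.BijOn σ D.triangles (A.sentences : Set α))
    (hA : ∀ (U : Finset α) (s : α), (U, s) ∈ A.rules ↔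
      ∃ e ∈ D.edges, ∃ t ∈ D.star e, (U : Set α) = σ '' (D.star e \ {t}) ∧ s = σ t)
    {X : Set (Finset V)} (hX : X ⊆ D.triangles) : A.infer (σ '' X) = σ '' D.spread X := by
  ext s
  constructor
  · rintro ⟨-, ⟨t, ht, rfl⟩ | ⟨U, hU, hUs⟩⟩
    · exact ⟨t, D.subset_spread hX ht, rfl⟩
    · obtain ⟨e, he, t, ht, hUe, rfl⟩ := (hA U s).1 hUs
      refine ⟨t, ⟨ht.1, Or.inr ⟨e, he, ht.2, fun t' h₁ h₂ h₃ => ?_⟩⟩, rfl⟩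
      have : σ t' ∈ σ '' X := hU (hUe ▸ ⟨t', ⟨⟨h₁, h₂⟩, h₃⟩, rfl⟩)
      obtain ⟨t'', ht'', heq⟩ := this
      exact hσ.injOn (hX ht'') h₁ heq ▸ ht''
  · rintro ⟨t, ⟨ht, h | ⟨e, he, het, h⟩⟩, rfl⟩
    · exact ⟨hσ.mapsTo ht, Or.inl ⟨t, h, rfl⟩⟩
    · have hfin : (σ '' (D.star e \ {t})).Finite :=
        (D.finite_triangles.subset fun _ h => h.1.1).image σ
      refine ⟨hσ.mapsTo ht, Or.inr ⟨hfin.toFinset, ?_,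
        (hA _ _).2 ⟨e, he, t, ⟨ht, het⟩, by simp, rfl⟩⟩⟩
      rw [Set.Finite.coe_toFinset]
      rintro _ ⟨t', ⟨⟨h₁, h₂⟩, h₃⟩, rfl⟩
      exact ⟨t', h t' h₁ h₂ h₃, rfl⟩

/-- The bijection carries iterates of `spread` to iterates of `infer`, and every subset of the
sentences is the image of a set of triangles of equal size. -/
theorem er_le_iff_exists_isAxiomSet {V α : Type} {D : Complex2 V} {A : AxiomSystem α}
    (h : IsEdgeStarSystem D A) (k : ℕ) :
    D.er ≤ k ↔ ∃ S₀ : Finset α, S₀.card ≤ k ∧ A.IsAxiomSet S₀ := by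
  classical
  obtain ⟨σ, hσ, hA⟩ := h
  have hiter : ∀ {X : Set (Finset V)}, X ⊆ D.triangles → ∀ n,
      A.infer^[n] (σ '' X) = σ '' D.spread^[n] X := by
    intro X hX n
    induction n with
    | zero => rfl
    | succ n ih =>
      rw [Function.iterate_succ_apply', Function.iterate_succ_apply', ih,
        infer_image hσ hA (D.iterate_spread_subset hX n)]
  rw [D.er_le_iff]
  constructor
  · rintro ⟨C, hC, hk, n, hn⟩
    -- An axiom set requires a positive number of rounds; one extra round is harmless, as the set of
    -- all triangles is fixed.
    refine ⟨C.image σ, Finset.card_image_le.trans hk, ?_, n + 1, n.succ_pos, ?_⟩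
    · intro s hs
      obtain ⟨t, ht, rfl⟩ := Finset.mem_image.1 hs
      exact hσ.mapsTo (hC ht)
    · rw [Finset.coe_image, hiter hC, D.iterate_spread_eq_of_le n.le_succ hn, hσ.image_eq]
  · rintro ⟨S₀, hk, hS₀, n, -, hn⟩
    obtain ⟨C, hC, hCS⟩ := (Set.subset_image_iff (f := σ) (s := D.triangles)
      (t := (S₀ : Set α))).1 (by rw [hσ.image_eq]; exact_mod_cast hS₀)
    lift C to Finset (Finset V) using D.finite_triangles.subset hC
    refine ⟨C, hC, ?_, n, ?_⟩
    · rw [← Finset.card_image_of_injOn (f := σ) (hσ.injOn.mono hC)]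
      have : C.image σ = S₀ := by exact_mod_cast hCS
      rwa [this]
    · rw [← hCS, hiter hC, ← hσ.image_eq] at hn
      exact (hσ.injOn.image_eq_image_iff (D.iterate_spread_subset hC n) subset_rfl).1 hn

/-! ### The axiom system of a complex -/

/-- A code for letters by words of length two. -/
def letterCode : Letter → Word
  | .bit false => [false, false]
  | .bit true => [false, true]
  | .comma => [true, true]
  | .semi => [true, false]

/-- A word over `{0, 1}` that stands for a word over the alphabet of the instances. -/
def quote (l : List Letter) : Word := l.flatMap letterCode

theorem quote_injective : Function.Injective quote := by
  intro l
  induction l with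
  | nil =>
    rintro (_ | ⟨a, l'⟩) h
    · rfl
    · rcases a with (_ | _) | _ | _ <;> simp [quote, letterCode] at h
  | cons a l ih =>
    rintro (_ | ⟨a', l'⟩) h
    · rcases a with (_ | _) | _ | _ <;> simp [quote, letterCode] at h
    · have key : a = a' ∧ quote l = quote l' := by
        rcases a with (_ | _) | _ | _ <;> rcases a' with (_ | _) | _ | _ <;>
          simp_all [quote, letterCode]
      rw [key.1, ih key.2]

/-- The name of the sentence that corresponds to a triangle. -/
def sentenceName (t : List Word) : Word := quote (encRow t)

theorem encRow_injective : Function.Injective encRow := fun l l' h =>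
  (encRow_append_inj (r := []) (r' := []) (by rw [h])).1

theorem sentenceName_injective : Function.Injective sentenceName :=
  quote_injective.comp encRow_injective

/-- The number of vertices of `t` other than `c` that belong to `t'`. -/
def overlap (c : Word) (t t' : List Word) : ℕ := ((t.filter (· ≠ c)).filter (· ∈ t')).length

/-- The triangle `t'` contains the edge of `t` that is opposite to `c`, and differs from `t`. -/
def IsNeighbour (c : Word) (t t' : List Word) : Prop := t' ≠ t ∧ overlap c t t' = 2

instance (c : Word) (t t' : List Word) : Decidable (IsNeighbour c t t') :=
  inferInstanceAs (Decidable (_ ∧ _))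

/-- Exactly two vertices of `t` differ from `c`, so a count of two means that none is missing in
`t'`. The counting form suits the expressions, which can compare numbers in unary notation. -/
theorem overlap_eq_two_iff {c : Word} {t t' : List Word} (ht : t.Nodup) (h3 : t.length = 3)
    (hc : c ∈ t) : overlap c t t' = 2 ↔ t.toFinset.erase c ⊆ t'.toFinset := by
  have h2 : (t.filter (· ≠ c)).length = 2 := by
    have h := ht.erase_eq_filter c
    have hl := List.length_erase_of_mem hc
    rw [h] at hl
    rw [h3] at hl
    convert hl using 3
    funext x
    by_cases hx : x = c <;> simp [hx]
  rw [overlap, ← h2, List.length_filter_eq_length_iff]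
  simp only [Finset.subset_iff, Finset.mem_erase, List.mem_toFinset, List.mem_filter,
    decide_eq_true_eq]
  exact ⟨fun h w hw => h w ⟨hw.2, hw.1⟩, fun h w hw => h ⟨hw.2, hw.1⟩⟩

namespace ComplexCode

/-- The listed triangles. -/
def triangleList (x : ComplexCode) : List (List Word) := x.simplexes.filter (·.length = 3)

theorem mem_triangleList {x : ComplexCode} {t : List Word} :
    t ∈ x.triangleList ↔ t ∈ x.simplexes ∧ t.length = 3 := by
  simp [triangleList]

theorem nodup_triangleList (x : ComplexCode) : x.triangleList.Nodup :=
  (List.Nodup.of_map _ x.nodup).filter _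

theorem toFinset_injOn (x : ComplexCode) {t t' : List Word} (ht : t ∈ x.triangleList)
    (ht' : t' ∈ x.triangleList) (h : t.toFinset = t'.toFinset) : t = t' :=
  List.inj_on_of_nodup_map x.nodup (mem_triangleList.1 ht).1 (mem_triangleList.1 ht').1 h

/-- A face with three vertices inside a listed simplex with at most three vertices is that simplex,
so every triangle is itself listed. -/
theorem mem_triangles_iff (x : ComplexCode) (s : Finset Word) :
    s ∈ x.complex.triangles ↔ ∃ t ∈ x.triangleList, t.toFinset = s := by
  constructor
  · rintro ⟨⟨-, l, hl, hs⟩, h3⟩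
    have h₁ := List.toFinset_card_le l
    have h₂ := x.length_le_three l hl
    have h₃ := Finset.card_le_card hs
    refine ⟨l, mem_triangleList.2 ⟨hl, by omega⟩, ?_⟩
    exact (Finset.eq_of_subset_of_card_le hs (by omega)).symm
  · rintro ⟨t, ht, rfl⟩
    rw [mem_triangleList] at ht
    have hc : t.toFinset.card = 3 := by
      rw [List.toFinset_card_of_nodup (x.nodup_vertices t ht.1), ht.2]
    exact ⟨⟨Finset.card_pos.1 (by omega), t, ht.1, subset_rfl⟩, hc⟩

theorem mem_edges_of_subset (x : ComplexCode) {e s : Finset Word} (hs : s ∈ x.complex.triangles)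
    (hes : e ⊆ s) (he : e.card = 2) : e ∈ x.complex.edges := by
  obtain ⟨⟨-, l, hl, hsl⟩, -⟩ := hs
  exact ⟨⟨Finset.card_pos.1 (by omega), l, hl, hes.trans hsl⟩, he⟩

/-- Edges of a triangle are indexed by their opposite vertices. This allows implications and edge
gates to be enumerated by pairs of a triangle and one of its vertices. -/
theorem exists_erase_eq (x : ComplexCode) {e : Finset Word} {t : List Word}
    (ht : t ∈ x.triangleList) (he : e.card = 2) (het : e ⊆ t.toFinset) :
    ∃ c ∈ t, e = t.toFinset.erase c := by
  have h3 := ((x.mem_triangles_iff _).2 ⟨t, ht, rfl⟩).2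
  obtain ⟨c, hc⟩ : ∃ c, t.toFinset \ e = {c} := by
    rw [← Finset.card_eq_one, Finset.card_sdiff_of_subset het]
    omega
  have hc' : c ∈ t.toFinset \ e := by rw [hc]; exact Finset.mem_singleton_self c
  refine ⟨c, List.mem_toFinset.1 (Finset.mem_sdiff.1 hc').1, ?_⟩
  rw [← Finset.sdiff_singleton_eq_erase, ← hc, Finset.sdiff_sdiff_eq_self het]

theorem erase_mem_edges (x : ComplexCode) {t : List Word} (ht : t ∈ x.triangleList) {c : Word}
    (hc : c ∈ t) : t.toFinset.erase c ∈ x.complex.edges := by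
  have h := (x.mem_triangles_iff _).2 ⟨t, ht, rfl⟩
  refine x.mem_edges_of_subset h (Finset.erase_subset _ _) ?_
  rw [Finset.card_erase_of_mem (List.mem_toFinset.2 hc), h.2]

theorem isNeighbour_iff (x : ComplexCode) {t t' : List Word} (ht : t ∈ x.triangleList)
    (ht' : t' ∈ x.triangleList) {c : Word} (hc : c ∈ t) :
    IsNeighbour c t t' ↔ t'.toFinset ≠ t.toFinset ∧ t.toFinset.erase c ⊆ t'.toFinset := by
  have h := mem_triangleList.1 ht
  rw [IsNeighbour, overlap_eq_two_iff (x.nodup_vertices t h.1) h.2 hc]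
  refine and_congr_left fun _ => not_congr ⟨fun h => by rw [h], x.toFinset_injOn ht' ht⟩

/-- The system of sentences and implications that is assigned to a complex. -/
def axiomCode (x : ComplexCode) : AxiomCode where
  sentences := x.triangleList.map sentenceName
  nodup := x.nodup_triangleList.map sentenceName_injective
  rules := x.triangleList.flatMap fun t => t.map fun c =>
    ((x.triangleList.filter (IsNeighbour c t)).map sentenceName, sentenceName t)
  rules_mem := by
    intro r hr
    simp only [List.mem_flatMap, List.mem_map] at hr
    obtain ⟨t, ht, c, -, rfl⟩ := hr
    refine ⟨fun u hu => ?_, List.mem_map_of_mem ht⟩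
    obtain ⟨t', ht', rfl⟩ := List.mem_map.1 hu
    exact List.mem_map_of_mem (List.mem_of_mem_filter ht')

/-- The sentence that corresponds to a triangle. -/
noncomputable def sentenceOf (x : ComplexCode) (s : Finset Word) : Word :=
  open Classical in
  if h : ∃ t ∈ x.triangleList, t.toFinset = s then sentenceName h.choose else []

theorem sentenceOf_toFinset (x : ComplexCode) {t : List Word} (ht : t ∈ x.triangleList) :
    x.sentenceOf t.toFinset = sentenceName t := by
  have h : ∃ t' ∈ x.triangleList, t'.toFinset = t.toFinset := ⟨t, ht, rfl⟩
  rw [sentenceOf, dif_pos h]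
  exact congrArg _ (x.toFinset_injOn h.choose_spec.1 ht h.choose_spec.2)

theorem bijOn_sentenceOf (x : ComplexCode) :
    Set.BijOn x.sentenceOf x.complex.triangles (x.axiomCode.system.sentences : Set Word) := by
  have hs : ∀ w, w ∈ (x.axiomCode.system.sentences : Set Word) ↔
      ∃ t ∈ x.triangleList, sentenceName t = w := by
    simp [AxiomCode.system, axiomCode]
  refine ⟨fun s h => ?_, fun s h s' h' heq => ?_, fun w h => ?_⟩
  · obtain ⟨t, ht, rfl⟩ := (x.mem_triangles_iff s).1 h
    exact (hs _).2 ⟨t, ht, (x.sentenceOf_toFinset ht).symm⟩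
  · obtain ⟨t, ht, rfl⟩ := (x.mem_triangles_iff s).1 h
    obtain ⟨t', ht', rfl⟩ := (x.mem_triangles_iff s').1 h'
    rw [x.sentenceOf_toFinset ht, x.sentenceOf_toFinset ht'] at heq
    rw [sentenceName_injective heq]
  · obtain ⟨t, ht, rfl⟩ := (hs w).1 h
    exact ⟨_, (x.mem_triangles_iff _).2 ⟨t, ht, rfl⟩, x.sentenceOf_toFinset ht⟩

theorem coe_premises (x : ComplexCode) {t : List Word} (ht : t ∈ x.triangleList) {c : Word}
    (hc : c ∈ t) :
    ((((x.triangleList.filter (IsNeighbour c t)).map sentenceName).toFinset : Finset Word) :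
      Set Word) =
    x.sentenceOf '' (x.complex.star (t.toFinset.erase c) \ {t.toFinset}) := by
  ext w
  simp only [List.coe_toFinset, Set.mem_ofPred_eq, List.mem_map, List.mem_filter,
    decide_eq_true_eq]
  constructor
  · rintro ⟨t', ⟨ht', hn⟩, rfl⟩
    rw [x.isNeighbour_iff ht ht' hc] at hn
    exact ⟨t'.toFinset, ⟨⟨(x.mem_triangles_iff _).2 ⟨t', ht', rfl⟩, hn.2⟩, hn.1⟩,
      x.sentenceOf_toFinset ht'⟩
  · rintro ⟨s, ⟨⟨h₁, h₂⟩, h₃⟩, rfl⟩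
    obtain ⟨t', ht', rfl⟩ := (x.mem_triangles_iff s).1 h₁
    exact ⟨t', ⟨ht', (x.isNeighbour_iff ht ht' hc).2 ⟨h₃, h₂⟩⟩, (x.sentenceOf_toFinset ht').symm⟩

theorem isEdgeStarSystem (x : ComplexCode) :
    IsEdgeStarSystem x.complex x.axiomCode.system := by
  refine ⟨x.sentenceOf, x.bijOn_sentenceOf, fun U s => ?_⟩
  have hr : (U, s) ∈ x.axiomCode.system.rules ↔ ∃ t ∈ x.triangleList, ∃ c ∈ t,
      U = ((x.triangleList.filter (IsNeighbour c t)).map sentenceName).toFinset ∧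
        s = sentenceName t := by
    simp only [AxiomCode.system, axiomCode, Set.mem_ofPred_eq, List.mem_flatMap, List.mem_map]
    constructor
    · rintro ⟨r, ⟨t, ht, c, hc, rfl⟩, h⟩
      exact ⟨t, ht, c, hc, Prod.mk.inj h⟩
    · rintro ⟨t, ht, c, hc, h₁, h₂⟩
      exact ⟨_, ⟨t, ht, c, hc, rfl⟩, Prod.ext h₁ h₂⟩
  rw [hr]
  constructor
  · rintro ⟨t, ht, c, hc, rfl, rfl⟩
    refine ⟨_, x.erase_mem_edges ht hc, t.toFinset,
      ⟨(x.mem_triangles_iff _).2 ⟨t, ht, rfl⟩, Finset.erase_subset _ _⟩, x.coe_premises ht hc,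
      (x.sentenceOf_toFinset ht).symm⟩
  · rintro ⟨e, he, s, ⟨hs, hes⟩, hU, rfl⟩
    obtain ⟨t, ht, rfl⟩ := (x.mem_triangles_iff s).1 hs
    obtain ⟨c, hc, rfl⟩ := x.exists_erase_eq ht he.2 hes
    refine ⟨t, ht, c, hc, ?_, x.sentenceOf_toFinset ht⟩
    rw [← x.coe_premises ht hc] at hU
    exact_mod_cast hU

end ComplexCode

/-! ### Evaluation of circuits -/

/-- The values of the gates after the gates in `l` have been evaluated. -/
def evalGates (a : Finset Word) (v : Word → Bool) (l : List Gate) : Word → Bool :=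
  l.foldl (fun v g => Function.update v g.name (g.value a v)) v

theorem evalGates_of_notMem {a : Finset Word} {w : Word} {l : List Gate} (v : Word → Bool)
    (h : w ∉ l.map Gate.name) : evalGates a v l w = v w := by
  induction l generalizing v with
  | nil => rfl
  | cons g l ih =>
    simp only [List.map_cons, List.mem_cons, not_or] at h
    rw [evalGates, List.foldl_cons]
    exact (ih _ h.2).trans (Function.update_of_ne h.1 _ _)

theorem Gate.value_congr {a : Finset Word} {v v' : Word → Bool} {g : Gate}
    (h : ∀ p ∈ g.preds, v p = v' p) : g.value a v = g.value a v' := by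
  have hl : ∀ f : Bool → Bool, (g.preds.all fun p => f (v p)) = g.preds.all fun p => f (v' p) := by
    intro f
    rw [Bool.eq_iff_iff, List.all_eq_true, List.all_eq_true]
    exact forall₂_congr fun p hp => by rw [h p hp]
  have hany : g.preds.any v = g.preds.any v' := by
    rw [Bool.eq_iff_iff, List.any_eq_true, List.any_eq_true]
    exact exists_congr fun p => and_congr_right fun hp => by rw [h p hp]
  unfold Gate.value
  cases g.kind
  · rfl
  · exact hl not
  · exact hl id
  · exact hany

/-- Distinct names mean that no value is overwritten later, and predecessors are evaluated before
the gate. The final valuation thus satisfies the equation of every gate, and the order of evaluation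
can be forgotten. -/
theorem Circuit.eval_name (C : Circuit) (a : Finset Word) {g : Gate} (hg : g ∈ C.gates) :
    C.eval a g.name = g.value a (C.eval a) := by
  obtain ⟨l₁, l₂, h⟩ := List.append_of_mem hg
  have hnd := C.nodup
  rw [h, List.map_append, List.map_cons, List.nodup_append] at hnd
  obtain ⟨-, hnd₂, hdisj⟩ := hnd
  have heval : C.eval a = evalGates a (Function.update (evalGates a (fun _ => false) l₁) g.name
      (g.value a (evalGates a (fun _ => false) l₁))) l₂ := by
    rw [Circuit.eval, h, List.foldl_append, List.foldl_cons]
    rfl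
  rw [heval, evalGates_of_notMem _ (List.nodup_cons.1 hnd₂).1, Function.update_self]
  refine Gate.value_congr fun p hp => ?_
  have hp₁ := C.topological l₁ g l₂ h p hp
  rw [evalGates_of_notMem (l := l₂), Function.update_of_ne]
  · exact fun he => hdisj p hp₁ p (by simp [he]) rfl
  · exact fun hm => hdisj p hp₁ p (List.mem_cons_of_mem _ hm) rfl

/-! ### The circuit of a complex -/

/-- The gates of the circuit of a complex: dummy inputs, gates that tell whether a triangle has been
erased when `m` rounds remain, gates that tell whether all other triangles that contain a
certain edge of a triangle have been erased, and the output gate. -/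
inductive GateId where
  | dummy (j : ℕ)
  | state (m : ℕ) (t : List Word)
  | edge (m : ℕ) (c : Word) (t : List Word)
  | out

namespace GateId

/-- A code for the gates. -/
def code : GateId → List Letter
  | dummy j => .semi :: List.replicate j .comma
  | state m t => .comma :: (encRow t ++ List.replicate m .comma)
  | edge m c t => .bit false :: (encWord c ++ (encRow t ++ List.replicate m .comma))
  | out => [.bit true]

/-- The first letter tells the four sorts of gates apart, encoded words and rows are
self-delimiting, and the number is read off the remaining length. -/
theorem code_injective : Function.Injective code := by
  rintro (j | ⟨m, t⟩ | ⟨m, c, t⟩ | _) (j' | ⟨m', t'⟩ | ⟨m', c', t'⟩ | _) h <;>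
    simp only [code, List.cons.injEq, reduceCtorEq, true_and, false_and, Letter.bit.injEq] at h
  · simpa using congrArg List.length h
  · obtain ⟨rfl, h'⟩ := encRow_append_inj h
    simpa using congrArg List.length h'
  · obtain ⟨rfl, h'⟩ := encWord_append_inj h
    obtain ⟨rfl, h''⟩ := encRow_append_inj h'
    simpa using congrArg List.length h''
  · rfl

/-- The names of the gates. -/
def name (i : GateId) : Word := quote i.code

theorem name_injective : Function.Injective name := quote_injective.comp code_injective

end GateId

namespace ComplexCode

variable (x : ComplexCode)

/-- The number of rounds. -/
def rounds : ℕ := (encTable x.simplexes).length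

/-- The gates that feed a gate. -/
def gatePreds : GateId → List GateId
  | .dummy _ => []
  | .state m t =>
    if m = x.rounds then [] else .state (m + 1) t :: t.map fun c => .edge m c t
  | .edge m c t => (x.triangleList.filter (IsNeighbour c t)).map (.state (m + 1))
  | .out => x.triangleList.map (.state 0)

/-- The kinds of the gates. -/
def gateKind : GateId → GateKind
  | .dummy _ => .input
  | .state m _ => if m = x.rounds then .input else .or
  | .edge _ _ _ => .and
  | .out => .and

/-- The gates. -/
def gate (i : GateId) : Gate := ⟨i.name, x.gateKind i, (x.gatePreds i).map GateId.name⟩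

/-- The gates of one round. -/
def layer (m : ℕ) : List GateId :=
  x.triangleList.flatMap fun t => (t.map fun c => .edge m c t) ++ [.state m t]

/-- All gates except for the output gate. -/
def innerIds (k : ℕ) : List GateId :=
  (List.range k).reverse.map .dummy ++ x.triangleList.map (.state x.rounds) ++
    (List.range x.rounds).reverse.flatMap x.layer

/-- All gates. -/
def gateIds (k : ℕ) : List GateId := x.innerIds k ++ [.out]

theorem mem_layer {m : ℕ} {i : GateId} : i ∈ x.layer m ↔
    ∃ t ∈ x.triangleList, i = .state m t ∨ ∃ c ∈ t, i = .edge m c t := by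
  simp only [layer, List.mem_flatMap, List.mem_append, List.mem_map, List.mem_singleton]
  refine exists_congr fun t => and_congr_right fun _ => ?_
  rw [or_comm]
  exact or_congr Iff.rfl (exists_congr fun c => and_congr_right fun _ => eq_comm)

theorem mem_gateIds {k : ℕ} {i : GateId} : i ∈ x.gateIds k ↔ (∃ j < k, i = .dummy j) ∨
    (∃ t ∈ x.triangleList, i = .state x.rounds t) ∨
    (∃ m < x.rounds, ∃ t ∈ x.triangleList, i = .state m t ∨ ∃ c ∈ t, i = .edge m c t) ∨
    i = .out := by
  simp only [gateIds, innerIds, List.mem_append, List.mem_map, List.mem_reverse, List.mem_range,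
    List.mem_flatMap, mem_layer, List.mem_singleton, eq_comm (b := i), or_assoc]

theorem nodup_layer (m : ℕ) : (x.layer m).Nodup := by
  rw [layer, List.nodup_flatMap]
  constructor
  · intro t ht
    rw [List.nodup_append]
    refine ⟨(x.nodup_vertices t (mem_triangleList.1 ht).1).map ?_, List.nodup_singleton _, ?_⟩
    · intro c c' h
      simpa using h
    · simp
  · refine x.nodup_triangleList.imp fun {t t'} h => ?_
    rw [Function.onFun, List.disjoint_left]
    intro i
    simp only [List.mem_append, List.mem_map, List.mem_singleton]
    rintro (⟨c, -, rfl⟩ | rfl) <;> simp [Ne.symm h, h]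

theorem nodup_gateIds (k : ℕ) : (x.gateIds k).Nodup := by
  have h₁ : ((List.range k).reverse.map GateId.dummy).Nodup :=
    (List.nodup_reverse.2 List.nodup_range).map fun j j' h => by simpa using h
  have h₂ : (x.triangleList.map (GateId.state x.rounds)).Nodup :=
    x.nodup_triangleList.map fun t t' h => by simpa using h
  have h₃ : ((List.range x.rounds).reverse.flatMap x.layer).Nodup := by
    rw [List.nodup_flatMap]
    refine ⟨fun m _ => x.nodup_layer m, ?_⟩
    refine (List.nodup_reverse.2 List.nodup_range).imp fun {m m'} h => ?_
    rw [Function.onFun, List.disjoint_left]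
    intro i hi hi'
    obtain ⟨t, -, rfl | ⟨c, -, rfl⟩⟩ := x.mem_layer.1 hi <;>
      obtain ⟨t', -, hi' | ⟨c', -, hi'⟩⟩ := x.mem_layer.1 hi' <;> simp [h] at hi'
  rw [gateIds, innerIds, List.nodup_append, List.nodup_append, List.nodup_append]
  refine ⟨⟨⟨h₁, h₂, ?_⟩, h₃, ?_⟩, List.nodup_singleton _, ?_⟩
  · intro i hi i' hi'
    obtain ⟨j, -, rfl⟩ := List.mem_map.1 hi
    obtain ⟨t, -, rfl⟩ := List.mem_map.1 hi'
    simp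
  · intro i hi i' hi'
    obtain ⟨m, hm, hi'⟩ := List.mem_flatMap.1 hi'
    rw [List.mem_reverse, List.mem_range] at hm
    rcases List.mem_append.1 hi with hi | hi
    · obtain ⟨j, -, rfl⟩ := List.mem_map.1 hi
      obtain ⟨t, -, rfl | ⟨c, -, rfl⟩⟩ := x.mem_layer.1 hi' <;> simp
    · obtain ⟨t, -, rfl⟩ := List.mem_map.1 hi
      obtain ⟨t, -, rfl | ⟨c, -, rfl⟩⟩ := x.mem_layer.1 hi' <;> simp
      -- Layers have `m < x.rounds`, whereas the inputs for triangles carry the index `x.rounds`.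
      omega
  · intro i hi i' hi'
    obtain rfl := List.mem_singleton.1 hi'
    rintro rfl
    simp [mem_layer] at hi

end ComplexCode

/-- The list is sorted topologically, where the elements of `S` precede the list. -/
def IsOrdered {α : Type} (P : α → List α) : Set α → List α → Prop
  | _, [] => True
  | S, i :: l => (∀ p ∈ P i, p ∈ S) ∧ IsOrdered P (insert i S) l

namespace IsOrdered

variable {α : Type} {P : α → List α}

theorem mono {S S' : Set α} {l : List α} (h : IsOrdered P S l) (hS : S ⊆ S') :
    IsOrdered P S' l := by
  induction l generalizing S S' with
  | nil => trivial
  | cons i l ih => exact ⟨fun p hp => hS (h.1 p hp), ih h.2 (Set.insert_subset_insert hS)⟩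

theorem append {S : Set α} {l l' : List α} (h : IsOrdered P S l)
    (h' : IsOrdered P (S ∪ {i | i ∈ l}) l') : IsOrdered P S (l ++ l') := by
  induction l generalizing S with
  | nil => exact h'.mono (by simp)
  | cons i l ih =>
    refine ⟨h.1, ih h.2 (h'.mono ?_)⟩
    rintro j (hj | hj)
    · exact Or.inl (Or.inr hj)
    · rcases List.mem_cons.1 hj with rfl | hj
      · exact Or.inl (Or.inl rfl)
      · exact Or.inr hj

theorem of_forall {S : Set α} {l : List α} (h : ∀ i ∈ l, ∀ p ∈ P i, p ∈ S) :
    IsOrdered P S l := by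
  induction l generalizing S with
  | nil => trivial
  | cons i l ih =>
    exact ⟨h i List.mem_cons_self, ih fun j hj p hp => Or.inr (h j (List.mem_cons_of_mem _ hj) p hp)⟩

theorem flatMap {β : Type} {S : Set α} {L : List β} {f : β → List α}
    (h : ∀ b ∈ L, IsOrdered P S (f b)) : IsOrdered P S (L.flatMap f) := by
  induction L with
  | nil => trivial
  | cons b L ih =>
    rw [List.flatMap_cons]
    exact (h b List.mem_cons_self).append
      ((ih fun b hb => h b (List.mem_cons_of_mem _ hb)).mono Set.subset_union_left)

theorem mem_of_eq {S : Set α} {l₁ l₂ : List α} {i : α} (h : IsOrdered P S (l₁ ++ i :: l₂)) {p : α}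
    (hp : p ∈ P i) : p ∈ S ∨ p ∈ l₁ := by
  induction l₁ generalizing S with
  | nil => exact Or.inl (h.1 p hp)
  | cons j l₁ ih =>
    rcases ih h.2 with (rfl | h) | h
    · exact Or.inr List.mem_cons_self
    · exact Or.inl h
    · exact Or.inr (List.mem_cons_of_mem _ h)

end IsOrdered

namespace ComplexCode

variable (x : ComplexCode)

theorem isOrdered_layer {m : ℕ} (hm : m ≠ x.rounds) {S : Set GateId}
    (hS : ∀ t ∈ x.triangleList, .state (m + 1) t ∈ S) :
    IsOrdered x.gatePreds S (x.layer m) := by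
  refine IsOrdered.flatMap fun t ht => IsOrdered.append (IsOrdered.of_forall ?_) ?_
  · intro i hi p hp
    obtain ⟨c, -, rfl⟩ := List.mem_map.1 hi
    obtain ⟨t', ht', rfl⟩ := List.mem_map.1 hp
    exact hS t' (List.mem_of_mem_filter ht')
  · refine ⟨fun p hp => ?_, trivial⟩
    rw [gatePreds, if_neg hm] at hp
    rcases List.mem_cons.1 hp with rfl | hp
    · exact Or.inl (hS t ht)
    · exact Or.inr hp

/-- The index counts the rounds that remain, so the layers are listed by decreasing `m`, and layer
`m` reads only itself and the states at `m + 1`. -/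
theorem isOrdered_layers {m : ℕ} (hm : m ≤ x.rounds) {S : Set GateId}
    (hS : ∀ t ∈ x.triangleList, .state m t ∈ S) :
    IsOrdered x.gatePreds S ((List.range m).reverse.flatMap x.layer ++ [.out]) := by
  induction m generalizing S with
  | zero =>
    refine ⟨fun p hp => ?_, trivial⟩
    obtain ⟨t, ht, rfl⟩ := List.mem_map.1 hp
    exact hS t ht
  | succ m ih =>
    rw [List.range_succ, List.reverse_concat, List.flatMap_cons, List.append_assoc]
    refine (x.isOrdered_layer (by omega) hS).append (ih (by omega) fun t ht => Or.inr ?_)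
    exact x.mem_layer.2 ⟨t, ht, Or.inl rfl⟩

theorem isOrdered_gateIds (k : ℕ) : IsOrdered x.gatePreds ∅ (x.gateIds k) := by
  rw [gateIds, innerIds, List.append_assoc]
  refine IsOrdered.append (IsOrdered.of_forall ?_) (x.isOrdered_layers le_rfl ?_)
  · intro i hi p hp
    rcases List.mem_append.1 hi with hi | hi
    · obtain ⟨j, -, rfl⟩ := List.mem_map.1 hi
      simp [gatePreds] at hp
    · obtain ⟨t, -, rfl⟩ := List.mem_map.1 hi
      simp [gatePreds] at hp
  · intro t ht
    exact Or.inr (List.mem_append_right _ (List.mem_map_of_mem ht))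

/-- The circuit of a complex. Its inputs select the triangles that are removed at the beginning; the
`k` dummy inputs have no effect. -/
def circuit (k : ℕ) : Circuit where
  gates := (x.gateIds k).map x.gate
  ne_nil := by simp [gateIds]
  nodup := by
    rw [List.map_map]
    exact (x.nodup_gateIds k).map GateId.name_injective
  arity_input := by
    intro g hg h
    obtain ⟨i, -, rfl⟩ := List.mem_map.1 hg
    cases i with
    | dummy j => rfl
    | state m t =>
      by_cases hm : m = x.rounds
      · simp [gate, gatePreds, hm]
      · simp [gate, gateKind, hm] at h
    | edge m c t => simp [gate, gateKind] at h
    | out => simp [gate, gateKind] at h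
  arity_not := by
    intro g hg h
    obtain ⟨i, -, rfl⟩ := List.mem_map.1 hg
    cases i with
    | state m t =>
      simp only [gate, gateKind] at h
      split_ifs at h
    | _ => simp [gate, gateKind] at h
  topological := by
    intro l₁ g l₂ h p hp
    obtain ⟨i₁, i₂', hi, rfl, hi₂⟩ := List.map_eq_append_iff.1 h
    obtain ⟨i, i₂, rfl, rfl, rfl⟩ := List.map_eq_cons_iff.1 hi₂
    obtain ⟨q, hq, rfl⟩ := List.mem_map.1 hp
    rcases (hi ▸ x.isOrdered_gateIds k).mem_of_eq hq with h | h
    · exact absurd h (Set.notMem_empty _)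
    · rw [List.map_map]
      exact List.mem_map_of_mem (f := Gate.name ∘ x.gate) h

theorem eval_circuit {k : ℕ} {i : GateId} (hi : i ∈ x.gateIds k) (a : Finset Word) :
    (x.circuit k).eval a i.name = (x.gate i).value a ((x.circuit k).eval a) :=
  (x.circuit k).eval_name a (g := x.gate i) (List.mem_map_of_mem hi)

/-! ### Correctness of the circuit -/

theorem mem_spread_iff {t : List Word} (ht : t ∈ x.triangleList) (X : Set (Finset Word)) :
    t.toFinset ∈ x.complex.spread X ↔ t.toFinset ∈ X ∨
      ∃ c ∈ t, ∀ t' ∈ x.triangleList, IsNeighbour c t t' → t'.toFinset ∈ X := by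
  have htt := (x.mem_triangles_iff _).2 ⟨t, ht, rfl⟩
  constructor
  · rintro ⟨-, h | ⟨e, he, het, h⟩⟩
    · exact Or.inl h
    · obtain ⟨c, hc, rfl⟩ := x.exists_erase_eq ht he.2 het
      refine Or.inr ⟨c, hc, fun t' ht' hn => ?_⟩
      rw [x.isNeighbour_iff ht ht' hc] at hn
      exact h _ ((x.mem_triangles_iff _).2 ⟨t', ht', rfl⟩) hn.2 hn.1
  · rintro (h | ⟨c, hc, h⟩)
    · exact ⟨htt, Or.inl h⟩
    · refine ⟨htt, Or.inr ⟨_, x.erase_mem_edges ht hc, Finset.erase_subset _ _, ?_⟩⟩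
      intro s hs hes hne
      obtain ⟨t', ht', rfl⟩ := (x.mem_triangles_iff s).1 hs
      exact h t' ht' ((x.isNeighbour_iff ht ht' hc).2 ⟨hne, hes⟩)

/-- The triangles that are selected by an assignment. -/
def selected (a : Finset Word) : Finset (Finset Word) :=
  (x.triangleList.toFinset.filter fun t => (GateId.state x.rounds t).name ∈ a).image List.toFinset

theorem toFinset_mem_selected {t : List Word} (ht : t ∈ x.triangleList) (a : Finset Word) :
    t.toFinset ∈ x.selected a ↔ (GateId.state x.rounds t).name ∈ a := by
  simp only [selected, Finset.mem_image, Finset.mem_filter, List.mem_toFinset]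
  constructor
  · rintro ⟨t', ⟨ht', h⟩, heq⟩
    exact x.toFinset_injOn ht' ht heq ▸ h
  · exact fun h => ⟨t, ⟨ht, h⟩, rfl⟩

theorem selected_subset (a : Finset Word) :
    (x.selected a : Set (Finset Word)) ⊆ x.complex.triangles := by
  intro s hs
  obtain ⟨t, ht, rfl⟩ := Finset.mem_image.1 hs
  exact (x.mem_triangles_iff _).2 ⟨t, List.mem_toFinset.1 (Finset.mem_filter.1 ht).1, rfl⟩

/-- Here `j` rounds are completed and `m` remain. The disjunction at a state gate and the
conjunctions at its edge gates reproduce `mem_spread_iff` literally. -/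
theorem eval_circuit_state (k : ℕ) (a : Finset Word) (j m : ℕ) (h : m + j = x.rounds)
    {t : List Word} (ht : t ∈ x.triangleList) :
    (x.circuit k).eval a (GateId.state m t).name = true ↔
      t.toFinset ∈ x.complex.spread^[j] (x.selected a : Set (Finset Word)) := by
  induction j generalizing m t with
  | zero =>
    obtain rfl : m = x.rounds := h
    rw [x.eval_circuit (x.mem_gateIds.2 (Or.inr (Or.inl ⟨t, ht, rfl⟩)))]
    simp only [Gate.value, gate, gateKind, if_true, decide_eq_true_eq]
    exact (x.toFinset_mem_selected ht a).symm
  | succ j ih =>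
    have hm : m < x.rounds := by omega
    have hm' : m ≠ x.rounds := hm.ne
    rw [Function.iterate_succ_apply', x.mem_spread_iff ht,
      x.eval_circuit (x.mem_gateIds.2 (Or.inr (Or.inr (Or.inl ⟨m, hm, t, ht, Or.inl rfl⟩))))]
    simp only [Gate.value, gate, gateKind, gatePreds, hm', if_false, List.map_cons, List.any_cons,
      Bool.or_eq_true, List.map_map, List.any_map, List.any_eq_true, Function.comp]
    refine or_congr (ih (m + 1) (by omega) ht)
      (exists_congr fun c => and_congr_right fun hc => ?_)
    rw [x.eval_circuit (x.mem_gateIds.2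
      (Or.inr (Or.inr (Or.inl ⟨m, hm, t, ht, Or.inr ⟨c, hc, rfl⟩⟩))))]
    simp only [Gate.value, gate, gateKind, gatePreds, List.all_eq_true, List.mem_map,
      List.mem_filter, decide_eq_true_eq]
    constructor
    · intro h t' ht' hn
      exact (ih (m + 1) (by omega) ht').1 (h _ ⟨_, ⟨t', ⟨ht', hn⟩, rfl⟩, rfl⟩)
    · rintro h _ ⟨_, ⟨t', ⟨ht', hn⟩, rfl⟩, rfl⟩
      exact (ih (m + 1) (by omega) ht').2 (h t' ht' hn)

theorem accepts_circuit_iff (k : ℕ) (a : Finset Word) : (x.circuit k).Accepts a ↔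
    x.complex.spread^[x.rounds] (x.selected a : Set (Finset Word)) = x.complex.triangles := by
  have hlast : ((x.circuit k).gates.getLast (x.circuit k).ne_nil).name = GateId.out.name := by
    simp [circuit, gateIds, gate]
  rw [Circuit.Accepts, hlast, x.eval_circuit (x.mem_gateIds.2 (Or.inr (Or.inr (Or.inr rfl))))]
  simp only [Gate.value, gate, gateKind, gatePreds, List.all_eq_true, List.mem_map]
  constructor
  · intro h
    refine (x.complex.iterate_spread_subset (x.selected_subset a) _).antisymm fun s hs => ?_
    obtain ⟨t, ht, rfl⟩ := (x.mem_triangles_iff s).1 hs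
    exact (x.eval_circuit_state k a _ 0 (Nat.zero_add _) ht).1 (h _ ⟨_, ⟨t, ht, rfl⟩, rfl⟩)
  · rintro h _ ⟨_, ⟨t, ht, rfl⟩, rfl⟩
    rw [x.eval_circuit_state k a _ 0 (Nat.zero_add _) ht, h]
    exact (x.mem_triangles_iff _).2 ⟨t, ht, rfl⟩

theorem mem_inputs_circuit (k : ℕ) (w : Word) : w ∈ (x.circuit k).inputs ↔
    (∃ j < k, w = (GateId.dummy j).name) ∨
      ∃ t ∈ x.triangleList, w = (GateId.state x.rounds t).name := by
  constructor
  · rintro ⟨g, hg, hin, rfl⟩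
    obtain ⟨i, hi, rfl⟩ := List.mem_map.1 hg
    rcases x.mem_gateIds.1 hi with ⟨j, hj, rfl⟩ | ⟨t, ht, rfl⟩ |
      ⟨m, hm, t, ht, rfl | ⟨c, hc, rfl⟩⟩ | rfl
    · exact Or.inl ⟨j, hj, rfl⟩
    · exact Or.inr ⟨t, ht, rfl⟩
    · simp [gate, gateKind, hm.ne] at hin
    · simp [gate, gateKind] at hin
    · simp [gate, gateKind] at hin
  · rintro (⟨j, hj, rfl⟩ | ⟨t, ht, rfl⟩)
    · exact ⟨_, List.mem_map_of_mem (x.mem_gateIds.2 (Or.inl ⟨j, hj, rfl⟩)), rfl, rfl⟩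
    · exact ⟨_, List.mem_map_of_mem (x.mem_gateIds.2 (Or.inr (Or.inl ⟨t, ht, rfl⟩))),
        by simp [gate, gateKind], rfl⟩

theorem length_le_length_encTable (t : List (List Word)) : t.length ≤ (encTable t).length := by
  rw [encTable, List.length_flatMap]
  refine le_trans (by simp) (List.card_nsmul_le_sum _ 1 ?_)
  simp only [List.mem_map, forall_exists_index, and_imp]
  rintro _ l - rfl
  simp [encRow]

/-- The length of the encoding is a generous number of rounds, but one over which an expression can
loop directly. -/
theorem ncard_triangles_le (x : ComplexCode) : x.complex.triangles.ncard ≤ x.rounds := by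
  have h : x.complex.triangles = (x.triangleList.toFinset.image List.toFinset :) := by
    ext s
    simp [x.mem_triangles_iff]
  rw [h, Set.ncard_coe_finset]
  refine Finset.card_image_le.trans ((List.toFinset_card_le _).trans ?_)
  exact (List.length_filter_le _ _).trans (length_le_length_encTable _)

/-- A removal set with fewer than `k` triangles is padded with dummy inputs to weight exactly `k`.
Conversely, dropping the dummies from an accepted assignment leaves at most `k` triangles. -/
theorem er_le_iff_exists_accepts (k : ℕ) : x.complex.er ≤ k ↔
    ∃ a : Finset Word, (a : Set Word) ⊆ (x.circuit k).inputs ∧ a.card = k ∧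
      (x.circuit k).Accepts a := by
  classical
  rw [x.complex.er_le_iff]
  constructor
  · rintro ⟨C, hC, hk, n, hn⟩
    set B := x.triangleList.toFinset.filter fun t => t.toFinset ∈ C with hB
    have hBC : B.image List.toFinset = C := by
      ext s
      simp only [hB, Finset.mem_image, Finset.mem_filter, List.mem_toFinset]
      constructor
      · rintro ⟨t, ⟨-, h⟩, rfl⟩
        exact h
      · intro hs
        obtain ⟨t, ht, rfl⟩ := (x.mem_triangles_iff s).1 (hC hs)
        exact ⟨t, ⟨ht, hs⟩, rfl⟩
    have hBcard : B.card = C.card := by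
      rw [← hBC, Finset.card_image_of_injOn]
      intro t ht t' ht' h
      simp only [hB, Finset.coe_filter, Set.mem_ofPred_eq, List.mem_toFinset] at ht ht'
      exact x.toFinset_injOn ht.1 ht'.1 h
    set b := B.image fun t => (GateId.state x.rounds t).name with hb
    set d := (Finset.range (k - C.card)).image fun j => (GateId.dummy j).name with hd
    have hbcard : b.card = C.card := by
      rw [hb, Finset.card_image_of_injective, hBcard]
      intro t t' h
      simpa using GateId.name_injective h
    have hdcard : d.card = k - C.card := by
      rw [hd, Finset.card_image_of_injective, Finset.card_range]
      intro j j' h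
      simpa using GateId.name_injective h
    have hdisj : Disjoint b d := by
      rw [Finset.disjoint_left]
      intro w hw hw'
      obtain ⟨t, -, rfl⟩ := Finset.mem_image.1 hw
      obtain ⟨j, -, h⟩ := Finset.mem_image.1 hw'
      simpa using GateId.name_injective h
    have hsel : x.selected (b ∪ d) = C := by
      rw [selected, ← hBC]
      congr 1
      ext t
      simp only [Finset.mem_filter, List.mem_toFinset, hB, Finset.mem_union, hb, hd,
        Finset.mem_image, Finset.mem_range]
      refine and_congr_right fun ht => ⟨?_, fun h => Or.inl ⟨t, ⟨ht, h⟩, rfl⟩⟩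
      rintro (⟨t', ⟨-, ht'⟩, h⟩ | ⟨j, -, h⟩)
      · have := GateId.name_injective h
        simp only [GateId.state.injEq, true_and] at this
        exact this ▸ ht'
      · exact absurd (GateId.name_injective h) (by simp)
    refine ⟨b ∪ d, ?_, ?_, ?_⟩
    · intro w hw
      rw [mem_inputs_circuit]
      rcases Finset.mem_union.1 (Finset.mem_coe.1 hw) with hw | hw
      · obtain ⟨t, ht, rfl⟩ := Finset.mem_image.1 hw
        exact Or.inr ⟨t, List.mem_toFinset.1 (Finset.mem_filter.1 ht).1, rfl⟩
      · obtain ⟨j, hj, rfl⟩ := Finset.mem_image.1 hw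
        exact Or.inl ⟨j, (Finset.mem_range.1 hj).trans_le (Nat.sub_le _ _), rfl⟩
    · rw [Finset.card_union_of_disjoint hdisj, hbcard, hdcard]
      omega
    · rw [accepts_circuit_iff, hsel]
      exact x.complex.iterate_spread_eq_triangles hC hn x.ncard_triangles_le
  · rintro ⟨a, -, hk, hacc⟩
    refine ⟨x.selected a, x.selected_subset a, ?_, x.rounds, (x.accepts_circuit_iff k a).1 hacc⟩
    rw [← hk]
    -- The selected triangles are counted by the names of their input gates, which are distinct
    -- elements of `a`.
    refine Finset.card_image_le.trans (Finset.card_le_card_of_injOn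
      (fun t => (GateId.state x.rounds t).name) (fun t ht => ?_) ?_)
    · exact (Finset.mem_filter.1 ht).2
    · intro t _ t' _ h
      simpa using GateId.name_injective h

end ComplexCode

/-! ### Expressions for the reductions -/

open StackProgram

noncomputable instance : DecidableEq Letter := Classical.decEq _

/-- Input words consist of the letters of the instance and the tally marks of the parameter. -/
abbrev InExp := Exp (Option Letter)

/-- A word over the alphabet of the instances as a part of an input word. -/
def lift (l : List Letter) : List (Option Letter) := l.map some

theorem lift_injective : Function.Injective lift :=
  List.map_injective_iff.2 (Option.some_injective _)

theorem lift_append (l l' : List Letter) : lift (l ++ l') = lift l ++ lift l' := List.map_append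

theorem lift_flatMap {α : Type} (l : List α) (f : α → List Letter) :
    lift (l.flatMap f) = l.flatMap fun a => lift (f a) := List.map_flatMap

/-! ### Loops over encoded words, rows and tables -/

theorem bindVars_apply {Γ : Type} (ρ : ℕ → List Γ) (p : ℕ) (x : List Γ × List Γ) (i : ℕ) :
    bindVars ρ p x i = if i = p + 1 then x.2 else if i = p then x.1 else ρ i := by
  simp only [bindVars, Function.update_apply]

theorem bindVars_of_lt {Γ : Type} (ρ : ℕ → List Γ) {p : ℕ} (x : List Γ × List Γ) {i : ℕ}
    (h : i < p) : bindVars ρ p x i = ρ i := by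
  rw [bindVars_apply, if_neg (by omega), if_neg (by omega)]

theorem bindVars_self {Γ : Type} (ρ : ℕ → List Γ) (p : ℕ) (x : List Γ × List Γ) :
    bindVars ρ p x p = x.1 := by
  rw [bindVars_apply, if_neg (by omega), if_pos rfl]

theorem pieces_append_cons {Γ : Type} {d : Γ → Bool} (acc u : List Γ) {b : Γ} (r : List Γ)
    (hu : ∀ a ∈ u, d a = false) (hb : d b = true) :
    pieces d acc (u ++ b :: r) = (acc ++ (u ++ [b]), r) :: pieces d [] r := by
  induction u generalizing acc with
  | nil => simp [pieces, hb]
  | cons a u ih =>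
    rw [List.cons_append, pieces, hu a List.mem_cons_self, if_neg (by simp),
      ih _ fun a ha => hu a (List.mem_cons_of_mem _ ha)]
    simp

/-- Every symbol ends a piece. -/
def always : Option Letter → Bool := fun _ => true

/-- The symbol is the letter `a`. -/
noncomputable def isLetter (a : Letter) : Option Letter → Bool := fun b => decide (b = some a)

theorem flatMap_pieces_always (X : List (Option Letter))
    (F : List (Option Letter) × List (Option Letter) → List (Option Letter))
    (G : Option Letter → List (Option Letter)) (h : ∀ a r, F ([a], r) = G a) :
    (pieces always [] X).flatMap F = X.flatMap G := by
  induction X with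
  | nil => rfl
  | cons a X ih =>
    rw [pieces, always, if_pos rfl, List.flatMap_cons, List.flatMap_cons, List.nil_append, h, ← ih]

/-- A loop over single symbols serves as a counter: the rests have lengths `X.length - 1, ..., 0`,
in the order in which the layers of the circuit are listed. -/
theorem flatMap_pieces_always_length (X : List (Option Letter))
    (F : List (Option Letter) × List (Option Letter) → List (Option Letter))
    (G : ℕ → List (Option Letter)) (h : ∀ a r, r.length < X.length → F ([a], r) = G r.length) :
    (pieces always [] X).flatMap F = (List.range X.length).reverse.flatMap G := by
  induction X with
  | nil => rfl
  | cons a X ih =>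
    rw [pieces, always, if_pos rfl, List.flatMap_cons, List.length_cons, List.range_succ,
      List.reverse_concat, List.flatMap_cons, List.nil_append, h _ _ (Nat.lt_succ_self _),
      ← ih fun a r hr => h a r (hr.trans (Nat.lt_succ_self _))]

/-- The semicolon at the end of the row is not followed by a comma and so belongs to no piece. -/
theorem flatMap_pieces_row (l : List Word)
    (F : List (Option Letter) × List (Option Letter) → List (Option Letter))
    (G : Word → List (Option Letter)) (h : ∀ w ∈ l, ∀ r, F (lift (encWord w), r) = G w) :
    (pieces (isLetter .comma) [] (lift (encRow l))).flatMap F = l.flatMap G := by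
  induction l with
  | nil => simp [encRow, lift, pieces, isLetter]
  | cons w l ih =>
    have hp := pieces_append_cons (d := isLetter .comma) [] (lift (w.map Letter.bit))
      (b := some .comma) (lift (encRow l)) (by
        intro a ha
        simp only [lift, List.mem_map] at ha
        obtain ⟨_, ⟨b, -, rfl⟩, rfl⟩ := ha
        simp [isLetter]) (by simp [isLetter])
    have he : lift (encRow (w :: l)) =
        lift (w.map Letter.bit) ++ some .comma :: lift (encRow l) := by
      simp [lift, encRow, encWord]
    have hw : lift (w.map Letter.bit) ++ [some .comma] = lift (encWord w) := by
      simp [lift, encWord]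
    rw [he, hp, List.flatMap_cons, List.flatMap_cons, List.nil_append, hw,
      h w List.mem_cons_self, ih fun w hw => h w (List.mem_cons_of_mem _ hw)]

theorem flatMap_pieces_table (t : List (List Word))
    (F : List (Option Letter) × List (Option Letter) → List (Option Letter))
    (G : List Word → List (Option Letter)) (h : ∀ l ∈ t, ∀ r, F (lift (encRow l), r) = G l) :
    (pieces (isLetter .semi) [] (lift (encTable t))).flatMap F = t.flatMap G := by
  induction t with
  | nil => rfl
  | cons l t ih =>
    have hp := pieces_append_cons (d := isLetter .semi) [] (lift (l.flatMap encWord))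
      (b := some .semi) (lift (encTable t)) (by
        intro a ha
        simp only [lift, List.mem_map, List.mem_flatMap, encWord, List.mem_append,
          List.mem_singleton] at ha
        obtain ⟨_, ⟨w, -, ⟨b, -, rfl⟩ | rfl⟩, rfl⟩ := ha <;> simp [isLetter]) (by simp [isLetter])
    have he : lift (encTable (l :: t)) =
        lift (l.flatMap encWord) ++ some .semi :: lift (encTable t) := by
      simp [lift, encTable, encRow]
    have hl : lift (l.flatMap encWord) ++ [some .semi] = lift (encRow l) := by
      simp [lift, encRow]
    rw [he, hp, List.flatMap_cons, List.flatMap_cons, List.nil_append, hl,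
      h l List.mem_cons_self, ih fun l hl => h l (List.mem_cons_of_mem _ hl)]

theorem flatMap_const {α β : Type} (l : List α) (b : β) :
    (l.flatMap fun _ => [b]) = List.replicate l.length b := by
  induction l with
  | nil => rfl
  | cons a l ih => rw [List.flatMap_cons, ih]; rfl

theorem flatMap_singleton_eq_map {α β : Type} (l : List α) (f : α → β) :
    (l.flatMap fun a => [f a]) = l.map f := by
  induction l with
  | nil => rfl
  | cons a l ih => rw [List.flatMap_cons, ih]; rfl

theorem flatMap_filter {α β : Type} (l : List α) (p : α → Bool) (f : α → List β) :
    (l.filter p).flatMap f = l.flatMap fun a => if p a then f a else [] := by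
  induction l with
  | nil => rfl
  | cons a l ih =>
    rw [List.flatMap_cons, ← ih]
    by_cases h : p a <;> simp [h]

namespace InExp

/-- A constant. -/
def const (l : List Letter) : InExp := .lit (lift l)

@[simp]
theorem eval_const (l : List Letter) (p : ℕ) (ρ : ℕ → List (Option Letter)) :
    Exp.eval (const l) p ρ = lift l := rfl

/-- The instance, without the parameter. -/
def instanceExp (p : ℕ) : InExp :=
  .loop always (.var 0) (.ifEq (.var p) (.lit [none]) (.lit []) (.var p))

/-- The tally marks of the parameter. -/
def tallyExp (p : ℕ) : InExp :=
  .loop always (.var 0) (.ifEq (.var p) (.lit [none]) (.var p) (.lit []))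

theorem eval_instanceExp (p : ℕ) {ρ : ℕ → List (Option Letter)} {s : List Letter} {k : ℕ}
    (h : ρ 0 = lift s ++ List.replicate k none) : Exp.eval (instanceExp p) p ρ = lift s := by
  rw [instanceExp, Exp.eval, flatMap_pieces_always (G := fun a => if a = none then [] else [a])]
  · have hk : ((List.replicate k none).flatMap fun a : Option Letter =>
        if a = none then [] else [a]) = [] := by
      simp +contextual [List.flatMap_eq_nil_iff, List.mem_replicate]
    simp only [Exp.eval, h, List.flatMap_append, hk, lift, List.flatMap_map, reduceCtorEq,
      if_false, flatMap_singleton_eq_map, List.append_nil]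
  · intro a r
    simp [Exp.eval, bindVars_self]

theorem eval_tallyExp (p : ℕ) {ρ : ℕ → List (Option Letter)} {s : List Letter} {k : ℕ}
    (h : ρ 0 = lift s ++ List.replicate k none) :
    Exp.eval (tallyExp p) p ρ = List.replicate k none := by
  rw [tallyExp, Exp.eval, flatMap_pieces_always (G := fun a => if a = none then [a] else [])]
  · have hk : ((List.replicate k none).flatMap fun a : Option Letter =>
        if a = none then [a] else []) = List.replicate k none := by
      clear h
      induction k with
      | zero => rfl
      | succ k ih => simp_all [List.replicate_succ]
    simp only [Exp.eval, h, List.flatMap_append, hk, lift, List.flatMap_map, reduceCtorEq,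
      if_false]
    simp
  · intro a r
    simp [Exp.eval, bindVars_self]

/-- A word that consists of as many commas as the value of an expression has symbols. -/
def unary (e : InExp) : InExp := .loop always e (const [.comma])

theorem eval_unary (e : InExp) (p : ℕ) (ρ : ℕ → List (Option Letter)) :
    Exp.eval (unary e) p ρ = lift (List.replicate (Exp.eval e p ρ).length .comma) := by
  rw [unary, Exp.eval, flatMap_pieces_always (G := fun _ => [some .comma])]
  · simp [lift, flatMap_const]
  · intro a r
    rfl

/-- The word over `{0, 1}`, followed by a comma, that stands for the value of an expression. -/
def quoteExp (p : ℕ) (e : InExp) : InExp :=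
  .append (.loop always e
    (.ifEq (.var p) (const [.bit false]) (const [.bit false, .bit false])
      (.ifEq (.var p) (const [.bit true]) (const [.bit false, .bit true])
        (.ifEq (.var p) (const [.comma]) (const [.bit true, .bit true])
          (const [.bit true, .bit false])))))
    (const [.comma])

theorem eval_quoteExp {e : InExp} {p : ℕ} {ρ : ℕ → List (Option Letter)} {s : List Letter}
    (h : Exp.eval e p ρ = lift s) : Exp.eval (quoteExp p e) p ρ = lift (encWord (quote s)) := by
  rw [quoteExp, Exp.eval, Exp.eval, h, flatMap_pieces_always (G := fun a =>
    if a = some (.bit false) then lift [.bit false, .bit false] else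
    if a = some (.bit true) then lift [.bit false, .bit true] else
    if a = some .comma then lift [.bit true, .bit true] else lift [.bit true, .bit false])]
  · rw [encWord, lift_append, eval_const]
    congr 1
    simp only [lift, quote, List.flatMap_map, List.map_flatMap]
    refine List.flatMap_congr fun a _ => ?_
    rcases a with (_ | _) | _ | _ <;> simp [letterCode]
  · intro a r
    simp [Exp.eval, bindVars_self, lift]

/-- For each of the words in the row that is the value of `e`. -/
noncomputable def forWords (e body : InExp) : InExp := .loop (isLetter .comma) e body

theorem eval_forWords {e body : InExp} {p : ℕ} {ρ : ℕ → List (Option Letter)} {l : List Word}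
    (h : Exp.eval e p ρ = lift (encRow l)) {G : Word → List (Option Letter)}
    (hG : ∀ w ∈ l, ∀ r, Exp.eval body (p + 2) (bindVars ρ p (lift (encWord w), r)) = G w) :
    Exp.eval (forWords e body) p ρ = l.flatMap G := by
  rw [forWords, Exp.eval, h]
  exact flatMap_pieces_row l _ G hG

/-- For each of the listed triangles. -/
noncomputable def forTriangles (p : ℕ) (body : InExp) : InExp :=
  .loop (isLetter .semi) (instanceExp p)
    (.ifEq (forWords (.var p) (const [.comma])) (const [.comma, .comma, .comma]) body (.lit []))

/-- Triangles are recognized by replacing each vertex by a comma and comparing with three commas. -/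
theorem eval_forTriangles {body : InExp} {p : ℕ} {ρ : ℕ → List (Option Letter)}
    {x : ComplexCode} {k : ℕ} (h : ρ 0 = lift (encTable x.simplexes) ++ List.replicate k none)
    {G : List Word → List (Option Letter)}
    (hG : ∀ t ∈ x.triangleList, ∀ r,
      Exp.eval body (p + 2) (bindVars ρ p (lift (encRow t), r)) = G t) :
    Exp.eval (forTriangles p body) p ρ = x.triangleList.flatMap G := by
  rw [forTriangles, Exp.eval, eval_instanceExp p h,
    flatMap_pieces_table _ _ fun t => if t.length = 3 then G t else []]
  · rw [ComplexCode.triangleList, flatMap_filter]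
    simp
  · intro t ht r
    have hc : Exp.eval (forWords (.var p) (const [.comma])) (p + 2)
        (bindVars ρ p (lift (encRow t), r)) = lift (List.replicate t.length .comma) := by
      rw [eval_forWords (l := t) (G := fun _ => [some .comma])]
      · simp [lift, flatMap_const]
      · simp [Exp.eval, bindVars_self]
      · intro w _ r
        rfl
    have h3 : lift (List.replicate t.length .comma) = lift [.comma, .comma, .comma] ↔
        t.length = 3 := by
      rw [lift_injective.eq_iff]
      exact ⟨fun h => by simpa using congrArg List.length h, fun h => by rw [h]; rfl⟩
    simp only [Exp.eval, hc, eval_const, h3]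
    split_ifs with hl
    · exact hG t (ComplexCode.mem_triangleList.2 ⟨ht, hl⟩) r
    · rfl

/-- The value of `e` if the triangle in the variable `t'` is a neighbour of that in `t` at the edge
opposite to the vertex in `c`. -/
noncomputable def ifNeighbour (p c t t' : ℕ) (e : InExp) : InExp :=
  .ifEq (.var t') (.var t) (.lit [])
    (.ifEq (forWords (.var t) (.ifEq (.var p) (.var c) (.lit [])
        (forWords (.var t') (.ifEq (.var (p + 2)) (.var p) (const [.comma]) (.lit [])))))
      (const [.comma, .comma]) e (.lit []))

theorem encWord_injective : Function.Injective encWord := fun w w' h =>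
  (encWord_append_inj (r := []) (r' := []) (by rw [h])).1

theorem flatMap_ite_eq {α β : Type} [DecidableEq α] {l : List α} (hl : l.Nodup) (a : α) (b : β) :
    (l.flatMap fun a' => if a' = a then [b] else []) = if a ∈ l then [b] else [] := by
  induction l with
  | nil => rfl
  | cons a' l ih =>
    rw [List.nodup_cons] at hl
    rw [List.flatMap_cons, ih hl.2]
    by_cases h : a' = a
    · subst h
      simp [hl.1]
    · simp [h, Ne.symm h]

theorem flatMap_ite_eq_replicate {α β : Type} (l : List α) (P Q : α → Prop) [DecidablePred P]
    [DecidablePred Q] (b : β) :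
    (l.flatMap fun a => if P a then [] else if Q a then [b] else []) =
      List.replicate ((l.filter (¬ P ·)).filter (Q ·)).length b := by
  induction l with
  | nil => rfl
  | cons a l ih =>
    rw [List.flatMap_cons, ih]
    by_cases hP : P a <;> by_cases hQ : Q a <;> simp [hP, hQ, List.replicate_succ]

/-- The overlap is computed in unary: each vertex of `t` other than `c` yields one comma for each
occurrence in `t'`, hence at most one, since `t'` has no repetitions. -/
theorem eval_ifNeighbour {p ci ti ti' : ℕ} (hc : ci < p) (ht' : ti' < p) {e : InExp}
    {ρ : ℕ → List (Option Letter)} {c : Word} {t t' : List Word} (hρc : ρ ci = lift (encWord c))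
    (hρt : ρ ti = lift (encRow t)) (hρt' : ρ ti' = lift (encRow t')) (hnd : t'.Nodup) :
    Exp.eval (ifNeighbour p ci ti ti' e) p ρ =
      if IsNeighbour c t t' then Exp.eval e p ρ else [] := by
  have key : Exp.eval (forWords (.var ti) (.ifEq (.var p) (.var ci) (.lit [])
        (forWords (.var ti') (.ifEq (.var (p + 2)) (.var p) (const [.comma]) (.lit []))))) p ρ =
      lift (List.replicate (overlap c t t') .comma) := by
    rw [eval_forWords (l := t) (G := fun w => if w = c then [] else
      if w ∈ t' then [some .comma] else [])]
    · rw [flatMap_ite_eq_replicate]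
      simp [lift, overlap]
    · simp [Exp.eval, hρt]
    · intro w _ r
      rw [Exp.eval, eval_forWords (l := t') (G := fun w' => if w' = w then [some .comma] else [])]
      · rw [flatMap_ite_eq hnd]
        by_cases hwc : w = c <;> simp [Exp.eval, bindVars_self, bindVars_of_lt, hc, hρc,
          lift_injective.eq_iff, encWord_injective.eq_iff, hwc]
      · simp [Exp.eval, bindVars_of_lt, ht', hρt']
      · intro w' _ r'
        by_cases hw : w' = w <;> simp [Exp.eval, bindVars_self, bindVars_of_lt,
          lift_injective.eq_iff, encWord_injective.eq_iff, hw]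
        rfl
  have h2 : lift (List.replicate (overlap c t t') .comma) = lift [.comma, .comma] ↔
      overlap c t t' = 2 := by
    rw [lift_injective.eq_iff]
    exact ⟨fun h => by simpa using congrArg List.length h, fun h => by rw [h]; rfl⟩
  -- Only the equation for `ifEq` is unfolded, so that the counting loop keeps the form in which
  -- `key` rewrites it.
  simp only [ifNeighbour, Exp.eval.eq_5, key]
  simp only [Exp.eval, hρt, hρt', eval_const, h2, lift_injective.eq_iff,
    encRow_injective.eq_iff, IsNeighbour]
  by_cases h : t' = t <;> simp [h]

/-- For each neighbour, stored in the variable `p`, of the triangle in the variable `t` at the edge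
opposite to the vertex in `c`. -/
noncomputable def forNeighbours (p c t : ℕ) (body : InExp) : InExp :=
  forTriangles p (ifNeighbour (p + 2) c t p body)

theorem eval_forNeighbours {p ci ti : ℕ} (hc : ci < p) (ht : ti < p) {body : InExp}
    {ρ : ℕ → List (Option Letter)} {x : ComplexCode} {k : ℕ}
    (h : ρ 0 = lift (encTable x.simplexes) ++ List.replicate k none)
    {c : Word} {t : List Word} (hρc : ρ ci = lift (encWord c)) (hρt : ρ ti = lift (encRow t))
    {G : List Word → List (Option Letter)}
    (hG : ∀ t' ∈ x.triangleList, ∀ r,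
      Exp.eval body (p + 2) (bindVars ρ p (lift (encRow t'), r)) = G t') :
    Exp.eval (forNeighbours p ci ti body) p ρ =
      (x.triangleList.filter (IsNeighbour c t)).flatMap G := by
  rw [forNeighbours, eval_forTriangles h (G := fun t' => if IsNeighbour c t t' then G t' else [])]
  · rw [flatMap_filter]
    simp
  · intro t' ht' r
    rw [eval_ifNeighbour (c := c) (t := t) (t' := t') (by omega) (by omega)
      (by rw [bindVars_of_lt _ _ hc, hρc]) (by rw [bindVars_of_lt _ _ ht, hρt])
      (by rw [bindVars_self]) (x.nodup_vertices t' (ComplexCode.mem_triangleList.1 ht').1),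
      hG t' ht' r]

/-- A word over `{0, 1}`, followed by a comma, for the sentence of the triangle in a variable. -/
def sentenceExp (p t : ℕ) : InExp := quoteExp p (.var t)

/-- The table of the axiom system of a complex, followed by the parameter. -/
noncomputable def axiomExp : InExp :=
  .append (.append (forTriangles 1 (sentenceExp 3 1)) (const [.semi]))
    (.append
      (forTriangles 1 (forWords (.var 1) (.append (sentenceExp 5 1)
        (.append (forNeighbours 5 3 1 (sentenceExp 7 5)) (const [.semi])))))
      (tallyExp 1))

theorem lift_encRow_map {α : Type} (l : List α) (f : α → Word) :
    lift (encRow (l.map f)) = (l.flatMap fun a => lift (encWord (f a))) ++ lift [.semi] := by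
  rw [encRow, lift_append, lift_flatMap, List.flatMap_map]

theorem lift_encRow_cons (w : Word) (l : List Word) :
    lift (encRow (w :: l)) = lift (encWord w) ++ lift (encRow l) := by
  simp [encRow, lift]

/-- Variable `0` holds the input, and each enclosing loop takes the next two variables: the triangle
is in `1`, the vertex in `3`, the neighbour in `5`. The rests of the words in between are not needed
here. -/
theorem apply_axiomExp (x : ComplexCode) (k : ℕ) :
    Exp.apply axiomExp (lift (encTable x.simplexes) ++ List.replicate k none) =
      lift (encTable x.axiomCode.table) ++ List.replicate k none := by
  set ρ : ℕ → List (Option Letter) := Function.update (fun _ => []) 0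
    (lift (encTable x.simplexes) ++ List.replicate k none) with hρ
  have h0 : ρ 0 = lift (encTable x.simplexes) ++ List.replicate k none := by simp [hρ]
  have h₁ : Exp.eval (forTriangles 1 (sentenceExp 3 1)) 1 ρ =
      x.triangleList.flatMap fun t => lift (encWord (sentenceName t)) := by
    refine eval_forTriangles h0 fun t _ r => eval_quoteExp ?_
    simp [Exp.eval, bindVars_self]
  have h₂ : Exp.eval (forTriangles 1 (forWords (.var 1) (.append (sentenceExp 5 1)
        (.append (forNeighbours 5 3 1 (sentenceExp 7 5)) (const [.semi]))))) 1 ρ =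
      x.triangleList.flatMap fun t => t.flatMap fun c => lift (encRow (sentenceName t ::
        (x.triangleList.filter (IsNeighbour c t)).map sentenceName)) := by
    refine eval_forTriangles h0 fun t _ r => eval_forWords ?_ fun c _ r' => ?_
    · simp [Exp.eval, bindVars_self]
    · rw [lift_encRow_cons, lift_encRow_map, Exp.eval, Exp.eval, eval_const]
      congr 1
      · exact eval_quoteExp (by simp [Exp.eval, bindVars_apply])
      · congr 1
        refine eval_forNeighbours (by omega) (by omega)
          (by simpa [bindVars_apply] using h0) (by simp [bindVars_apply])
          (by simp [bindVars_apply]) fun t' _ r'' => eval_quoteExp ?_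
        simp [Exp.eval, bindVars_apply]
  rw [Exp.apply, axiomExp, Exp.eval, Exp.eval, Exp.eval, ← hρ, h₁, h₂, eval_tallyExp 1 h0,
    eval_const]
  simp only [AxiomCode.table, ComplexCode.axiomCode, encTable, List.flatMap_cons, lift_append,
    lift_encRow_map, lift_flatMap, List.map_flatMap, List.flatMap_assoc, List.flatMap_map,
    List.map_map, List.append_assoc, Function.comp]

/-! ### The table of the circuit as an expression -/

/-- The code of a state gate. -/
def stateExp (t m : InExp) : InExp := .append (const [.comma]) (.append t (unary m))

/-- The code of an edge gate. -/
def edgeExp (c t m : InExp) : InExp :=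
  .append (const [.bit false]) (.append c (.append t (unary m)))

theorem eval_stateExp {t m : InExp} {p : ℕ} {ρ : ℕ → List (Option Letter)} {u : List Word} {n : ℕ}
    (ht : Exp.eval t p ρ = lift (encRow u)) (hm : (Exp.eval m p ρ).length = n) :
    Exp.eval (stateExp t m) p ρ = lift (GateId.state n u).code := by
  rw [stateExp, Exp.eval, Exp.eval, ht, eval_unary, hm, eval_const, ← lift_append, ← lift_append]
  rfl

theorem eval_edgeExp {c t m : InExp} {p : ℕ} {ρ : ℕ → List (Option Letter)} {w : Word}
    {u : List Word} {n : ℕ} (hc : Exp.eval c p ρ = lift (encWord w))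
    (ht : Exp.eval t p ρ = lift (encRow u)) (hm : (Exp.eval m p ρ).length = n) :
    Exp.eval (edgeExp c t m) p ρ = lift (GateId.edge n w u).code := by
  rw [edgeExp, Exp.eval, Exp.eval, Exp.eval, hc, ht, eval_unary, hm, eval_const, ← lift_append,
    ← lift_append, ← lift_append]
  rfl

/-- A row for a gate with given kind, name and predecessors. -/
def gateExp (d : GateKind) (n ps : InExp) : InExp :=
  .append (const (encWord d.code)) (.append n (.append ps (const [.semi])))

theorem eval_gateExp {d : GateKind} {n ps : InExp} {p : ℕ} {ρ : ℕ → List (Option Letter)}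
    {i : GateId} {l : List GateId} (hn : Exp.eval n p ρ = lift (encWord i.name))
    (hps : Exp.eval ps p ρ = l.flatMap fun j => lift (encWord j.name)) :
    Exp.eval (gateExp d n ps) p ρ =
      lift (encRow (d.code :: i.name :: l.map GateId.name)) := by
  rw [gateExp, Exp.eval, Exp.eval, Exp.eval, hn, hps, lift_encRow_cons, lift_encRow_cons,
    lift_encRow_map, eval_const, eval_const]

/-- The row of a gate of the circuit of a complex. -/
def gateRow (x : ComplexCode) (i : GateId) : List (Option Letter) :=
  lift (encRow ((x.gateKind i).code :: i.name :: (x.gatePreds i).map GateId.name))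

/-- The rows of the dummy inputs. -/
def dummiesExp : InExp :=
  .loop always (.var 0) (.ifEq (.var 1) (.lit [none])
    (gateExp .input (quoteExp 3 (.append (const [.semi]) (unary (.var 2)))) (.lit [])) (.lit []))

/-- The rows of the inputs for the triangles. -/
noncomputable def inputsExp : InExp :=
  forTriangles 1 (gateExp .input (quoteExp 3 (stateExp (.var 1) (instanceExp 3))) (.lit []))

/-- The rows of the gates of all rounds. -/
noncomputable def layersExp : InExp :=
  .loop always (instanceExp 1) (forTriangles 3 (.append
    (forWords (.var 3) (gateExp .and (quoteExp 7 (edgeExp (.var 5) (.var 3) (.var 2)))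
      (forNeighbours 7 5 3 (quoteExp 9 (stateExp (.var 7) (.append (.var 1) (.var 2)))))))
    (gateExp .or (quoteExp 5 (stateExp (.var 3) (.var 2)))
      (.append (quoteExp 5 (stateExp (.var 3) (.append (.var 1) (.var 2))))
        (forWords (.var 3) (quoteExp 7 (edgeExp (.var 5) (.var 3) (.var 2))))))))

/-- The row of the output gate. -/
noncomputable def outputExp : InExp :=
  gateExp .and (quoteExp 1 (const [.bit true]))
    (forTriangles 1 (quoteExp 3 (stateExp (.var 1) (.lit []))))

/-- The table of the circuit of a complex, followed by the parameter. -/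
noncomputable def circuitExp : InExp :=
  .append (.append (.append dummiesExp inputsExp) (.append layersExp outputExp)) (tallyExp 1)

variable {x : ComplexCode} {k : ℕ} {ρ : ℕ → List (Option Letter)}

/-- The tally marks stand at the end of the input, so the rest after a mark consists of `j` marks
and supplies the index of a dummy. Letters of the instance contribute nothing. -/
theorem eval_dummiesExp (h0 : ρ 0 = lift (encTable x.simplexes) ++ List.replicate k none) :
    Exp.eval dummiesExp 1 ρ =
      ((List.range k).reverse.map GateId.dummy).flatMap (gateRow x) := by
  have hsome : ∀ (s : List Letter) (y : List (Option Letter))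
      (F : List (Option Letter) × List (Option Letter) → List (Option Letter)),
      (∀ a r, F ([some a], r) = []) →
      (pieces always [] (lift s ++ y)).flatMap F = (pieces always [] y).flatMap F := by
    intro s y F hF
    induction s with
    | nil => rfl
    | cons a s ih =>
      change (pieces always [] (some a :: (lift s ++ y))).flatMap F = _
      rw [pieces, always, if_pos rfl, List.flatMap_cons, List.nil_append, hF, ← ih]
      rfl
  have hnone : ∀ (F : List (Option Letter) × List (Option Letter) → List (Option Letter))
      (G : ℕ → List (Option Letter)),
      (∀ j, F ([none], List.replicate j none) = G j) →
      (pieces always [] (List.replicate k none)).flatMap F =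
        (List.range k).reverse.flatMap G := by
    intro F G hF
    clear h0
    induction k with
    | zero => rfl
    | succ k ih =>
      rw [List.replicate_succ, pieces, always, if_pos rfl, List.flatMap_cons, List.range_succ,
        List.reverse_concat, List.flatMap_cons, List.nil_append, hF, ← ih]
  rw [dummiesExp, Exp.eval.eq_4, Exp.eval.eq_2, h0, hsome _ _ _ ?_, hnone _ _ ?_,
    List.flatMap_map]
  · intro j
    have : Exp.eval (gateExp .input (quoteExp 3 (.append (const [.semi]) (unary (.var 2))))
        (.lit [])) 3 (bindVars ρ 1 ([none], List.replicate j none)) =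
        gateRow x (GateId.dummy j) := by
      refine eval_gateExp (eval_quoteExp ?_) rfl
      rw [Exp.eval, eval_unary, eval_const, ← lift_append]
      simp [Exp.eval, bindVars_apply, GateId.code]
    simpa [Exp.eval, bindVars_apply] using this
  · intro a r
    simp [Exp.eval, bindVars_apply]

theorem eval_inputsExp (h0 : ρ 0 = lift (encTable x.simplexes) ++ List.replicate k none) :
    Exp.eval inputsExp 1 ρ =
      (x.triangleList.map (GateId.state x.rounds)).flatMap (gateRow x) := by
  rw [List.flatMap_map]
  refine eval_forTriangles h0 fun t _ r => ?_
  have hk : x.gateKind (.state x.rounds t) = .input := if_pos rfl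
  have hp : x.gatePreds (.state x.rounds t) = [] := if_pos rfl
  rw [gateRow, hk, hp]
  refine eval_gateExp (eval_quoteExp (eval_stateExp ?_ ?_)) rfl
  · simp [Exp.eval, bindVars_apply]
  · rw [eval_instanceExp 3 (s := encTable x.simplexes) (k := k)
      (by simpa [bindVars_apply] using h0)]
    simp [lift, ComplexCode.rounds]

/-- In the loop over the symbols of the instance, the rest in variable `2` has length `m`; together
with the symbol in variable `1` it has length `m + 1`. These words give the indices of the present
layer and of the one that it reads. The triangle, the vertex and the neighbour are in `3`, `5` and
`7`. -/
theorem eval_layersExp (h0 : ρ 0 = lift (encTable x.simplexes) ++ List.replicate k none) :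
    Exp.eval layersExp 1 ρ =
      ((List.range x.rounds).reverse.flatMap x.layer).flatMap (gateRow x) := by
  rw [layersExp, Exp.eval, eval_instanceExp 1 h0, List.flatMap_assoc,
    flatMap_pieces_always_length (G := fun m => (x.layer m).flatMap (gateRow x))]
  · simp [lift, ComplexCode.rounds]
  · intro a rest hrest
    -- A proper rest is shorter than the instance, so the state gates of the layer are disjunctions
    -- and not inputs.
    have hm : rest.length ≠ x.rounds := by
      simp only [lift, List.length_map] at hrest
      exact hrest.ne
    rw [ComplexCode.layer, List.flatMap_assoc]
    refine eval_forTriangles (by simpa [bindVars_apply] using h0) fun t _ r => ?_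
    rw [Exp.eval, List.flatMap_append, List.flatMap_map, List.flatMap_singleton]
    congr 1
    · refine eval_forWords (by simp [Exp.eval, bindVars_apply]) fun c _ r' => ?_
      refine eval_gateExp (eval_quoteExp (eval_edgeExp ?_ ?_ ?_)) ?_
      · simp [Exp.eval, bindVars_apply]
      · simp [Exp.eval, bindVars_apply]
      · simp [Exp.eval, bindVars_apply]
      · rw [ComplexCode.gatePreds, List.flatMap_map]
        refine eval_forNeighbours (by omega) (by omega) (by simpa [bindVars_apply] using h0)
          (by simp [bindVars_apply]) (by simp [bindVars_apply])
          fun t' _ r'' => eval_quoteExp (eval_stateExp ?_ ?_)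
        · simp [Exp.eval, bindVars_apply]
        · simp [Exp.eval, bindVars_apply]
    · have hk : x.gateKind (.state rest.length t) = .or := if_neg hm
      have hp : x.gatePreds (.state rest.length t) = .state (rest.length + 1) t ::
        t.map fun c => .edge rest.length c t := if_neg hm
      rw [gateRow, hk, hp]
      refine eval_gateExp (eval_quoteExp (eval_stateExp ?_ ?_)) ?_
      · simp [Exp.eval, bindVars_apply]
      · simp [Exp.eval, bindVars_apply]
      · rw [Exp.eval, List.flatMap_cons, List.flatMap_map]
        congr 1
        · refine eval_quoteExp (eval_stateExp ?_ ?_)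
          · simp [Exp.eval, bindVars_apply]
          · simp [Exp.eval, bindVars_apply]
        · refine eval_forWords (by simp [Exp.eval, bindVars_apply]) fun c _ r' =>
            eval_quoteExp (eval_edgeExp ?_ ?_ ?_)
          · simp [Exp.eval, bindVars_apply]
          · simp [Exp.eval, bindVars_apply]
          · simp [Exp.eval, bindVars_apply]

theorem eval_outputExp (h0 : ρ 0 = lift (encTable x.simplexes) ++ List.replicate k none) :
    Exp.eval outputExp 1 ρ = gateRow x .out := by
  refine eval_gateExp (eval_quoteExp rfl) ?_
  rw [ComplexCode.gatePreds, List.flatMap_map]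
  refine eval_forTriangles h0 fun t _ r => eval_quoteExp (eval_stateExp ?_ ?_)
  · simp [Exp.eval, bindVars_apply]
  · rfl

theorem apply_circuitExp (x : ComplexCode) (k : ℕ) :
    Exp.apply circuitExp (lift (encTable x.simplexes) ++ List.replicate k none) =
      lift (encTable (x.circuit k).table) ++ List.replicate k none := by
  set ρ : ℕ → List (Option Letter) := Function.update (fun _ => []) 0
    (lift (encTable x.simplexes) ++ List.replicate k none) with hρ
  have h0 : ρ 0 = lift (encTable x.simplexes) ++ List.replicate k none := by simp [hρ]
  have hrow : lift (encTable (x.circuit k).table) = (x.gateIds k).flatMap (gateRow x) := by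
    rw [encTable, lift_flatMap, Circuit.table, List.flatMap_map, ComplexCode.circuit,
      List.flatMap_map]
    rfl
  rw [Exp.apply, circuitExp, ← hρ, Exp.eval, Exp.eval, Exp.eval, Exp.eval, eval_dummiesExp h0,
    eval_inputsExp h0, eval_layersExp h0, eval_outputExp h0, eval_tallyExp 1 h0, hrow,
    ComplexCode.gateIds, ComplexCode.innerIds]
  simp only [List.flatMap_append, List.append_assoc, List.flatMap_singleton]

end InExp

/-! ### The reductions -/

theorem exists_machine_of_exp (e : InExp) :
    ∃ (M : Turing.TM2ComputableAux (Option Letter) (Option Letter)) (f : ℕ → ℕ) (c : ℕ),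
      ∀ (s : List Letter) (k : ℕ) (y : List (Option Letter)),
        e.apply (lift s ++ List.replicate k none) = y →
        Nonempty (Turing.TM2OutputsInTime M.tm
          ((lift s ++ List.replicate k none).map M.inputAlphabet.symm)
          (some (y.map M.outputAlphabet.symm)) (f k * (s.length + 1) ^ c)) := by
  let : Fintype Letter := Fintype.ofFinite _
  obtain ⟨p, i, o, C, d, h⟩ := Exp.exists_machine e
  refine ⟨⟨p.machine i o, Equiv.refl _, Equiv.refl _⟩, fun k => C * (k + 1) ^ d, d, ?_⟩
  rintro s k y rfl
  obtain ⟨r⟩ := h (lift s ++ List.replicate k none)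
  -- The input has length `s.length + k`, and `s.length + k + 1 ≤ (k + 1) * (s.length + 1)`
  -- separates the parameter from the instance.
  have hT : C * ((lift s ++ List.replicate k none).length + 1) ^ d ≤
      C * (k + 1) ^ d * (s.length + 1) ^ d := by
    rw [mul_assoc, ← mul_pow]
    refine Nat.mul_le_mul_left _ (Nat.pow_le_pow_left ?_ _)
    simp only [lift, List.length_append, List.length_map, List.length_replicate]
    nlinarith
  -- The words are generalized because mapping by the identity equivalence has to be rewritten away
  -- inside the type of the computation.
  have key : ∀ u v : List (Option Letter), u = lift s ++ List.replicate k none →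
      v = e.apply (lift s ++ List.replicate k none) →
      Nonempty (Turing.TM2OutputsInTime (p.machine i o) u (some v)
        (C * (k + 1) ^ d * (s.length + 1) ^ d)) := by
    rintro _ _ rfl rfl
    exact ⟨⟨r.toEvalsTo, r.steps_le_m.trans hT⟩⟩
  exact key _ _ (List.map_id _) (List.map_id _)

end ParamMorse

theorem theorem3 :
    (∃ T : ParamMorse.ComplexCode → ℕ → ParamMorse.AxiomCode,
      ParamMorse.IsFPTReduction ParamMorse.erasability ParamMorse.minimumAxiomSet T id ∧
      ∀ (x : ParamMorse.ComplexCode) (k : ℕ),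
        ParamMorse.IsEdgeStarSystem x.complex (T x k).system) ∧
    ParamMorse.InWP ParamMorse.erasability := by
  refine ⟨⟨fun x _ => x.axiomCode, ⟨fun x k => ?_, ?_⟩, fun x _ => x.isEdgeStarSystem⟩,
    fun x k => x.circuit k, id, fun x k => x.er_le_iff_exists_accepts k, ?_⟩
  · exact ParamMorse.er_le_iff_exists_isAxiomSet x.isEdgeStarSystem k
  · obtain ⟨M, f, c, h⟩ := ParamMorse.exists_machine_of_exp ParamMorse.InExp.axiomExp
    exact ⟨M, f, c, fun x k => h _ k _ (ParamMorse.InExp.apply_axiomExp x k)⟩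
  · obtain ⟨M, f, c, h⟩ := ParamMorse.exists_machine_of_exp ParamMorse.InExp.circuitExp
    exact ⟨M, f, c, fun x k => h _ k _ (ParamMorse.InExp.apply_circuitExp x k)⟩
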